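/- **Theorem 1.2.** Let $\mathbb{F}_q$ be a finite field, let $d_1,\dots,d_R$ be natural numbers, and put $C=\prod_{i=1}^R d_i^{d_i}$. There is a constant $K>0$, depending only on $q$ and $d_1,\dots,d_R$, with the following property. Let $n\ge 0$ be an integer, let $X\subset\mathbb{P}^{n-1}$ be the projective variety over $\mathbb{F}_q$ defined by forms $F_1,\dots,F_R\in\mathbb{F}_q[x_1,\dots,x_n]$ of degrees $d_1,\dots,d_R$ (for instance a smooth Fano variety; neither smoothness nor the Fano property is required), let $U\subset X$ be a Zariski open subset defined over $\mathbb{F}_q$, and let $e\ge 0$ be an integer. Let $H$ be the naive height on $\mathbb{P}^{n-1}(\mathbb{F}_q(t))$, so that $H(x)=q^{\max_j\deg x_j}$ if $x=(x_1:\dots:x_n)$ with coprime $x_1,\dots,x_n\in\mathbb{F}_q[t]$, and let $$N_U(e)=\#\{x\in U(\mathbb{F}_q(t)) : H(x)=q^e\}.$$ Let $\mathrm{Mor}_{e,U}(\mathbb{P}^1,X)$ be the space of morphisms $f\colon\mathbb{P}^1\to X$ over $\overline{\mathbb{F}}_q$ with $\deg f^*\mathcal{O}_X(1)=e$ and $f(\mathbb{P}^1)\cap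 U\neq\emptyset$, a locally closed subset of $\mathbb{P}^{n(e+1)-1}$ via the coefficients of the binary forms of degree $e$ that define $f$. Then $N_U(e)$ is finite. If $\mathrm{Mor}_{e,U}(\mathbb{P}^1,X)$ is empty, then $N_U(e)=0$; otherwise its dimension is a natural number and $$N_U(e)\le K\, C^e\, q^{\dim \mathrm{Mor}_{e,U}(\mathbb{P}^1,X)}.$$ -/

import Mathlib

open scoped LinearAlgebra.Projectivization

noncomputable section

namespace RatCurves

/-! ### Projective varieties and their open subsets -/

section Varieties

variable {k : Type*} [Field k] {n : ℕ} {ι : Type*}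

/-- The set `X(L)` of `L`-points of the projective variety `X = V(F_i : i) ⊆ ℙ^{n-1}` defined over
`k` by the family of forms `F`, where `L` is an extension field of `k`. As the `F i` are
homogeneous, their vanishing does not depend on the chosen coordinates of the point. -/
def zeroLocus (F : ι → MvPolynomial (Fin n) k) (L : Type*) [Field L] [Algebra k L] :
    Set (ℙ L (Fin n → L)) :=
  {P | ∀ i, MvPolynomial.aeval P.rep (F i) = 0}

/-- The set `U(L)` of `L`-points of the Zariski open subset `U = X \ V(G)` of `X = V(F)`, where
`G` is a set of forms over `k`. Every Zariski open subset of `X` has this shape. -/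
def openLocus (F : ι → MvPolynomial (Fin n) k) (G : Set (MvPolynomial (Fin n) k))
    (L : Type*) [Field L] [Algebra k L] : Set (ℙ L (Fin n → L)) :=
  {P | P ∈ zeroLocus F L ∧ ∃ g ∈ G, MvPolynomial.aeval P.rep g ≠ 0}

end Varieties

/-! ### Dimension -/

section Dimension

variable {L : Type*} [Field L] {σ : Type*}

/-- The Zariski topology on the set of `L`-points of projective space: the topology generated
by the principal open sets `F ≠ 0`, for `F` a form. -/
@[reducible]
def zariskiTopology (L : Type*) [Field L] (σ : Type*) : TopologicalSpace (ℙ L (σ → L)) :=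
  TopologicalSpace.generateFrom
    {S | ∃ (m : ℕ) (F : MvPolynomial σ L), F.IsHomogeneous m ∧
      S = {P | MvPolynomial.eval P.rep F ≠ 0}}

/-- The dimension of a subset of projective space (over an algebraically closed field, in all
applications): the Krull dimension of the subset with the Zariski topology. It is `⊥` exactly
for the empty set. -/
def zariskiDim (S : Set (ℙ L (σ → L))) : WithBot ℕ∞ :=
  letI := zariskiTopology L σ
  topologicalKrullDim S

end Dimension

/-! ### The space of morphisms -/

section Morphisms

variable {L : Type*} [Field L] {n e : ℕ}

/-- The value at `(s, u)` of the `n`-tuple of binary forms of degree `e` with coefficient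
vector `a`, that is the vector `(∑ₖ a_{jk} s^k u^{e-k})_j`. -/
def formTuple (a : Fin n × Fin (e + 1) → L) (p : Fin 2 → L) : Fin n → L :=
  fun j => ∑ k : Fin (e + 1), a (j, k) * p 0 ^ (k : ℕ) * p 1 ^ (e - (k : ℕ))

variable {k : Type*} [Field k] {ι : Type*}

/-- `Mor_{e,U}(ℙ¹, X)` as a (locally closed) subset of `ℙ^{n(e+1)-1}` over the algebraic closure
of `k`. A morphism `ℙ¹ → ℙ^{n-1}` with `deg f^*O(1) = e` is an `n`-tuple of binary forms of degree
`e` without common zero on `ℙ¹`, up to a common scalar, so it is a point of `ℙ^{n(e+1)-1}`;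
it is a morphism to `X` if all its values lie in `X`, and its image has to meet `U`. -/
def morSpace (F : ι → MvPolynomial (Fin n) k) (G : Set (MvPolynomial (Fin n) k)) (e : ℕ) :
    Set (ℙ (AlgebraicClosure k) (Fin n × Fin (e + 1) → AlgebraicClosure k)) :=
  {f | (∀ p : Fin 2 → AlgebraicClosure k, p ≠ 0 →
          ∃ h : formTuple f.rep p ≠ 0,
            Projectivization.mk _ (formTuple f.rep p) h ∈ zeroLocus F (AlgebraicClosure k)) ∧
       ∃ p : Fin 2 → AlgebraicClosure k, p ≠ 0 ∧
          ∃ h : formTuple f.rep p ≠ 0,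
            Projectivization.mk _ (formTuple f.rep p) h ∈ openLocus F G (AlgebraicClosure k)}

end Morphisms

/-! ### The naive height -/

section Height

open Polynomial

variable {k : Type*} [Field k] {n : ℕ}

/-- `y` is a vector of primitive (coprime polynomial) homogeneous coordinates of the point `P`
of `ℙ^{n-1}(k(t))`. -/
def IsPrimitiveRep (P : ℙ (RatFunc k) (Fin n → RatFunc k)) (y : Fin n → k[X]) : Prop :=
  Ideal.span (Set.range y) = ⊤ ∧
    ∃ h : (fun j => algebraMap k[X] (RatFunc k) (y j)) ≠ 0,
      P = Projectivization.mk (RatFunc k) (fun j => algebraMap k[X] (RatFunc k) (y j)) h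

theorem exists_isPrimitiveRep (P : ℙ (RatFunc k) (Fin n → RatFunc k)) :
    ∃ y : Fin n → k[X], IsPrimitiveRep P y := by
  obtain ⟨b, hb⟩ := IsLocalization.exist_integer_multiples_of_finite (nonZeroDivisors k[X]) P.rep
  choose z hz using hb
  have hb0 : algebraMap k[X] (RatFunc k) (b : k[X]) ≠ 0 :=
    IsLocalization.to_map_ne_zero_of_mem_nonZeroDivisors _ le_rfl b.2
  obtain ⟨g, hg⟩ := (IsPrincipalIdealRing.principal (Ideal.span (Set.range z))).principal
  have hdvd : ∀ j, ∃ w, z j = g * w := fun j => by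
    have : z j ∈ Ideal.span {g} := by
      change z j ∈ Submodule.span k[X] {g}
      rw [← hg]; exact Ideal.subset_span ⟨j, rfl⟩
    exact Ideal.mem_span_singleton.mp this
  choose y hy using hdvd
  have hz0 : ∃ j, z j ≠ 0 := by
    by_contra! hcon
    apply P.rep_nonzero
    funext j
    have := hz j
    rw [hcon j, map_zero, Algebra.smul_def] at this
    exact (mul_eq_zero.mp this.symm).resolve_left hb0
  have hg0 : g ≠ 0 := by
    rintro rfl
    obtain ⟨j, hj⟩ := hz0
    exact hj (by rw [hy j, zero_mul])
  have hg0' : algebraMap k[X] (RatFunc k) g ≠ 0 := by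
    simpa using hg0
  have hrel : ∀ j, algebraMap k[X] (RatFunc k) g * algebraMap k[X] (RatFunc k) (y j) =
      algebraMap k[X] (RatFunc k) (b : k[X]) * P.rep j := fun j => by
    have := hz j
    rw [Algebra.smul_def] at this
    rw [← map_mul, ← hy j, this]
  have hne : (fun j => algebraMap k[X] (RatFunc k) (y j)) ≠ 0 := by
    intro h0
    obtain ⟨j, hj⟩ := hz0
    apply hj
    have : algebraMap k[X] (RatFunc k) (y j) = 0 := congrFun h0 j
    have hyj : y j = 0 := by simpa using this
    rw [hy j, hyj, mul_zero]
  refine ⟨y, ?_, hne, ?_⟩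
  · have hmem : g ∈ Ideal.span (Set.range z) := by
      rw [hg]; exact Submodule.mem_span_singleton_self g
    obtain ⟨c, hc⟩ := Ideal.mem_span_range_iff_exists_fun.mp hmem
    rw [Ideal.eq_top_iff_one]
    refine Ideal.mem_span_range_iff_exists_fun.mpr ⟨c, ?_⟩
    apply mul_left_cancel₀ hg0
    rw [Finset.mul_sum, mul_one]
    conv_rhs => rw [← hc]
    exact Finset.sum_congr rfl fun j _ => by rw [hy j]; ring
  · conv_lhs => rw [← P.mk_rep]
    rw [Projectivization.mk_eq_mk_iff']
    refine ⟨(algebraMap k[X] (RatFunc k) (b : k[X]))⁻¹ * algebraMap k[X] (RatFunc k) g, ?_⟩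
    funext j
    simp only [Pi.smul_apply, smul_eq_mul]
    rw [mul_assoc, hrel j, inv_mul_cancel_left₀ hb0]

/-- The logarithmic naive height of a point of `ℙ^{n-1}(k(t))`: the maximum of the degrees of
primitive homogeneous coordinates. -/
def logHeight (P : ℙ (RatFunc k) (Fin n → RatFunc k)) : ℕ :=
  Finset.univ.sup fun j => (Classical.choose (exists_isPrimitiveRep P) j).natDegree

theorem IsPrimitiveRep.logHeight_eq {P : ℙ (RatFunc k) (Fin n → RatFunc k)} {y : Fin n → k[X]}
    (hy : IsPrimitiveRep P y) : logHeight P = Finset.univ.sup fun j => (y j).natDegree := by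
  unfold logHeight
  generalize hzdef : Classical.choose (exists_isPrimitiveRep P) = z
  obtain ⟨hz, hz0, hPz⟩ : IsPrimitiveRep P z :=
    hzdef ▸ Classical.choose_spec (exists_isPrimitiveRep P)
  clear hzdef
  obtain ⟨hy1, hy0, hPy⟩ := hy
  have hPz := hPy.symm.trans hPz
  rw [Projectivization.mk_eq_mk_iff'] at hPz
  obtain ⟨c, hc⟩ := hPz
  obtain ⟨a, b, hb, rfl⟩ := IsFractionRing.div_surjective (A := k[X]) c
  have hb0 : b ≠ 0 := nonZeroDivisors.ne_zero hb
  have hb0' : algebraMap k[X] (RatFunc k) b ≠ 0 := by simpa using hb0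
  have key : ∀ j, a * z j = b * y j := fun j => by
    have h := congrFun hc j
    simp only [Pi.smul_apply, smul_eq_mul] at h
    apply IsFractionRing.injective k[X] (RatFunc k)
    rw [map_mul, map_mul, ← h]
    field_simp
  have hab : b ∣ a := by
    obtain ⟨r, hr⟩ := Ideal.mem_span_range_iff_exists_fun.mp ((Ideal.eq_top_iff_one _).mp hz)
    refine ⟨∑ j, r j * y j, ?_⟩
    rw [← mul_one a, ← hr, Finset.mul_sum, Finset.mul_sum]
    exact Finset.sum_congr rfl fun j _ => by linear_combination r j * key j
  have hba : a ∣ b := by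
    obtain ⟨r, hr⟩ := Ideal.mem_span_range_iff_exists_fun.mp ((Ideal.eq_top_iff_one _).mp hy1)
    refine ⟨∑ j, r j * z j, ?_⟩
    rw [← mul_one b, ← hr, Finset.mul_sum, Finset.mul_sum]
    exact Finset.sum_congr rfl fun j _ => by linear_combination -r j * key j
  obtain ⟨u, rfl⟩ := associated_of_dvd_dvd hab hba
  refine Finset.sup_congr rfl fun j _ => ?_
  have h : (u : k[X]) * z j = y j := by
    apply mul_left_cancel₀ hb0
    rw [← key j]; ring
  rw [← h]
  exact (Polynomial.natDegree_eq_of_degree_eq (by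
    rw [Polynomial.degree_mul, Polynomial.degree_coe_units, zero_add])).symm

/-- The naive height `H : ℙ^{n-1}(𝔽_q(t)) → q^ℤ`, where `q` is the cardinality of the
finite field `k`. -/
def height (P : ℙ (RatFunc k) (Fin n → RatFunc k)) : ℕ :=
  Nat.card k ^ logHeight P

/-- The set of rational points of `U = V(F) \ V(G)` over `k(t)` of height `q ^ e`. -/
def ratPoints {ι : Type*} (F : ι → MvPolynomial (Fin n) k) (G : Set (MvPolynomial (Fin n) k))
    (e : ℕ) : Set (ℙ (RatFunc k) (Fin n → RatFunc k)) :=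
  {P | P ∈ openLocus F G (RatFunc k) ∧ height P = Nat.card k ^ e}

end Height

end RatCurves

end

/-! A rational point of height q^e has coprime polynomial coordinates of degree at most e. Their
coefficients form a vector in F_q^{n(e+1)} on the affine cone over the space of morphisms
(`exists_coeffVector`), and this vector determines the point. The cone is locally closed. Its closed
conditions are the vanishing of the coefficients of F_i(y(t)): d_i e + 1 equations of degree d_i for
each i, with degrees multiplying to a constant times C^e.

It remains to count vectors with entries in a finite set T, here T = F_q. Suppose equations of
degrees δ_k define a set in affine N-space of local dimension at most r at the counted points. Then
there are at most ∏ δ_k · |T|^r of them (`card_points_le`). Indeed N - r suitable combinations of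
the equations already cut the local dimension down to r, with product of degrees at most ∏ δ_k, and
r suitable combinations of the polynomials ∏_{c ∈ T} (x_i - c), of degree |T|, make every counted
point isolated. Bézout's inequality for isolated zeros of N equations in N unknowns
(`card_isolated_zeros_le`) finishes the count. It follows from a dimension count, because the powers
of the ideal of the system grow at an isolated zero as they would for independent variables
(`quasiRegular`).

The local dimension is measured by chains of primes. On the cone over a set of dimension D it is at
most D + 1: chains of homogeneous primes give chains of irreducible closed subsets
(`chainDim_lineIdeal_le_zariskiDim`), and Krull's height theorem accounts for the passage to the
cone (`chainDim_point_le`). The extra dimension costs a factor q, which goes into K. -/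

namespace RatCurves

open MvPolynomial

/-! ### Minimal primes and heights of points of affine space -/

section Minimal

variable {R : Type*} [CommRing R]

/-- In the localization at a minimal prime `p` of `I`, the radical of the extension of `I` is the
maximal ideal; clearing denominators gives `s`. -/
theorem exists_mul_pow_mem_of_mem_minimalPrimes {I p : Ideal R} (hp : p ∈ I.minimalPrimes)
    {x : R} (hx : x ∈ p) : ∃ s ∉ p, ∃ m : ℕ, s * x ^ m ∈ I := by
  have hp₁ : p.IsPrime := hp.1.1
  have h : algebraMap R (Localization.AtPrime p) x ∈
      (I.map (algebraMap R (Localization.AtPrime p))).radical := by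
    rw [IsLocalization.AtPrime.radical_map_of_mem_minimalPrimes _ p I hp]
    exact Ideal.mem_map_of_mem _ hx
  obtain ⟨m, hm⟩ := h
  rw [IsLocalization.mem_map_algebraMap_iff (M := p.primeCompl)] at hm
  obtain ⟨⟨a, b⟩, hm⟩ := hm
  rw [← map_pow, ← map_mul, IsLocalization.eq_iff_exists p.primeCompl] at hm
  obtain ⟨t, ht⟩ := hm
  refine ⟨t * b, (t * b).2, m, ?_⟩
  simp only at ht
  rw [show (t : R) * b * x ^ m = t * a by rw [← ht]; ring]
  exact I.mul_mem_left _ a.2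

end Minimal

section Points

variable {L σ : Type*} [Field L]

theorem mem_point {v : σ → L} {p : MvPolynomial σ L} :
    p ∈ vanishingIdeal L ({v} : Set (σ → L)) ↔ eval v p = 0 := by
  rw [mem_vanishingIdeal_singleton_iff, aeval_eq_eval]

instance point_isMaximal (v : σ → L) : (vanishingIdeal L ({v} : Set (σ → L))).IsMaximal := by
  have : vanishingIdeal L ({v} : Set (σ → L)) = RingHom.ker (eval v : MvPolynomial σ L →+* L) := by
    ext p; rw [mem_point, RingHom.mem_ker]
  rw [this]
  exact RingHom.ker_isMaximal_of_surjective _ fun c => ⟨C c, by simp⟩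

/-- Translation of the coordinates of affine space. -/
noncomputable def translate (a : σ → L) : MvPolynomial σ L ≃ₐ[L] MvPolynomial σ L :=
  AlgEquiv.ofAlgHom (aeval fun i => X i + C (a i)) (aeval fun i => X i - C (a i))
    (by ext i; simp) (by ext i; simp)

theorem eval_translate (a v : σ → L) (p : MvPolynomial σ L) :
    eval v (translate a p) = eval (v + a) p := by
  have : (eval v).comp (translate a : MvPolynomial σ L →+* MvPolynomial σ L) = eval (v + a) := by
    ext i <;> simp [translate]
  exact congrArg (fun f => f p) this

theorem comap_translate_point (a v : σ → L) :
    (vanishingIdeal L ({v} : Set (σ → L))).comap (translate a).toRingEquiv =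
      vanishingIdeal L {v + a} := by
  ext p
  rw [Ideal.mem_comap, mem_point, mem_point, ← eval_translate]
  rfl

/-- By the Nullstellensatz every maximal ideal is a point, and translations permute the points
transitively. So all maximal ideals have the same height, which must be the dimension of the ring.
-/
theorem height_point [IsAlgClosed L] [Finite σ] (v : σ → L) :
    (vanishingIdeal L ({v} : Set (σ → L))).height = Nat.card σ := by
  have hdim : ringKrullDim (MvPolynomial σ L) = Nat.card σ := by simp
  apply le_antisymm
  · have := Ideal.height_le_ringKrullDim_of_ne_top (I := vanishingIdeal L ({v} : Set (σ → L)))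
      Ideal.IsPrime.ne_top'
    rw [hdim] at this
    exact_mod_cast this
  · have key : ringKrullDim (MvPolynomial σ L) ≤
        ((vanishingIdeal L ({v} : Set (σ → L))).height : WithBot ℕ∞) := by
      rw [ringKrullDim_le_iff_isMaximal_height_le]
      intro M hM
      obtain ⟨w, rfl⟩ := isMaximal_iff_eq_vanishingIdeal_singleton.mp hM
      rw [show w = v + (w - v) by simp, ← comap_translate_point, RingEquiv.height_comap]
    rw [hdim] at key
    exact_mod_cast key

end Points

/-! ### Isolated zeros: quasi-regularity and independence over the subring generated by the system
-/

section QuasiRegular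

variable {L σ : Type*} [Field L] [IsAlgClosed L]

theorem eval_smul_of_isHomogeneous {R τ : Type*} [CommSemiring R] {F : MvPolynomial τ R} {a : ℕ}
    (hF : F.IsHomogeneous a) (t : R) (u : τ → R) :
    eval (fun i => t * u i) F = t ^ a * eval u F := by
  simp only [eval_eq, Finset.mul_sum]
  refine Finset.sum_congr rfl fun d hd => ?_
  have hda : ∑ i ∈ d.support, d i = a := by
    rw [hF.degree_eq_sum_deg_support hd]
  simp only [mul_pow, Finset.prod_mul_distrib, Finset.prod_pow_eq_pow_sum, hda]
  ring

/-- A system of parameters of the local ring of affine space at a point is quasi-regular. -/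
theorem quasiRegular [Finite σ] {g : σ → MvPolynomial σ L} {v : σ → L}
    (hv : vanishingIdeal L {v} ∈ (Ideal.span (Set.range g)).minimalPrimes)
    {c : MvPolynomial σ L} {a : ℕ} (hc : c.IsHomogeneous a) (hc0 : c ≠ 0)
    {w : MvPolynomial σ L} (hw : w ∉ vanishingIdeal L ({v} : Set (σ → L))) :
    w * aeval g c ∉ Ideal.span (Set.range g) ^ (a + 1) := by
  classical
  intro hmem
  have := Fintype.ofFinite σ
  set m := vanishingIdeal L ({v} : Set (σ → L)) with hm
  have hJm : Ideal.span (Set.range g) ≤ m := hv.1.2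
  obtain ⟨u, hu⟩ : ∃ u : σ → L, eval u c ≠ 0 := by
    by_contra! h
    exact hc0 (MvPolynomial.funext fun x => by rw [h x, map_zero])
  have hcm : C (eval u c) ∉ m := by
    rw [hm, mem_point, eval_C]; exact hu
  by_cases hu0 : ∃ i, u i ≠ 0
  swap
  -- If `c` is nonzero only at the origin, its degree is 0 and it is a nonzero constant, so
  -- membership would put `w` in `m`.
  · push Not at hu0
    have hzero : u = fun i => 0 * u i := by funext i; simp [hu0 i]
    have ha : a = 0 := by
      by_contra ha
      apply hu
      rw [hzero, eval_smul_of_isHomogeneous hc, zero_pow ha, zero_mul]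
    subst ha
    obtain ⟨r, rfl⟩ : ∃ r, c = C r := by
      exact ⟨_, totalDegree_eq_zero_iff_eq_C.mp (Nat.le_zero.mp hc.totalDegree_le)⟩
    rw [zero_add, pow_one] at hmem
    rw [eval_C] at hcm
    rw [aeval_C] at hmem
    exact (Ideal.IsPrime.mem_or_mem inferInstance (hJm hmem)).elim hw hcm
  obtain ⟨i₀, hi₀⟩ := hu0
  -- Restrict to the locus where `g` is proportional to `u`. It is cut out by one equation fewer
  -- than there are variables, yet a relation in `J^(a+1)` would make `v` an isolated point of it,
  -- against Krull's height theorem.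
  set S : Finset (MvPolynomial σ L) :=
    (Finset.univ.erase i₀).image fun i => g i - C (u i / u i₀) * g i₀ with hS
  have hmin : m ∈ (Ideal.span (S : Set (MvPolynomial σ L))).minimalPrimes := by
    refine ⟨⟨inferInstance, ?_⟩, ?_⟩
    · rw [Ideal.span_le]
      intro x hx
      obtain ⟨i, -, rfl⟩ := Finset.mem_image.mp hx
      exact sub_mem (hJm (Ideal.subset_span ⟨i, rfl⟩))
        (Ideal.mul_mem_left _ _ (hJm (Ideal.subset_span ⟨i₀, rfl⟩)))
    · rintro p ⟨hp, hSp⟩ hpm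
      suffices h : g i₀ ∈ p by
        refine hv.2 ⟨hp, Ideal.span_le.mpr ?_⟩ hpm
        rintro _ ⟨i, rfl⟩
        by_cases hi : i = i₀
        · exact hi ▸ h
        · have : g i - C (u i / u i₀) * g i₀ ∈ p :=
            hSp (Ideal.subset_span (Finset.mem_image.mpr ⟨i, by simp [hi], rfl⟩))
          simpa using add_mem this (p.mul_mem_left (C (u i / u i₀)) h)
      set φ := Ideal.Quotient.mk p
      set t := φ (g i₀)
      have hgi : ∀ i, φ (g i) = t * φ (C (u i / u i₀)) := by
        intro i
        by_cases hi : i = i₀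
        · subst hi; rw [div_self hi₀]; simp [t]
        · have : g i - C (u i / u i₀) * g i₀ ∈ p :=
            hSp (Ideal.subset_span (Finset.mem_image.mpr ⟨i, by simp [hi], rfl⟩))
          rw [← sub_eq_zero, mul_comm, ← map_mul, ← map_sub]
          exact Ideal.Quotient.eq_zero_iff_mem.mpr this
      have hu' : eval u c = u i₀ ^ a * eval (fun i => u i / u i₀) c := by
        rw [← eval_smul_of_isHomogeneous hc]
        congr 2; funext i; field_simp
      set r := eval (fun i => u i / u i₀) c
      have hr : C r ∉ m := by
        rw [hm, mem_point, eval_C]; rintro h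
        exact hu (by rw [hu', h, mul_zero])
      have hgc : φ (aeval g c) = t ^ a * φ (C r) := by
        have h1 : φ (aeval g c) = eval (fun i => t * φ (C (u i / u i₀))) (map (φ.comp C) c) := by
          have : φ.comp (aeval g : MvPolynomial σ L →ₐ[L] MvPolynomial σ L).toRingHom =
              (eval fun i => t * φ (C (u i / u i₀))).comp (map (φ.comp C)) := by
            ext i <;> simp [hgi]
          exact congrArg (fun f => f c) this
        rw [h1, eval_smul_of_isHomogeneous (hc.map _)]
        congr 1
        have : (eval fun i => φ (C (u i / u i₀))).comp (map (φ.comp C)) =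
            (φ.comp C).comp (eval fun i => u i / u i₀) := by
          ext i <;> simp
        exact congrArg (fun f => f c) this
      have hpow : φ (w * aeval g c) ∈ Ideal.span {t ^ (a + 1)} := by
        rw [← Ideal.span_singleton_pow]
        have := Ideal.mem_map_of_mem φ hmem
        rw [Ideal.map_pow] at this
        refine Ideal.pow_right_mono ?_ _ this
        rw [Ideal.map_span, Ideal.span_le]
        rintro _ ⟨_, ⟨i, rfl⟩, rfl⟩
        rw [hgi]
        exact Ideal.mul_mem_right _ _ (Ideal.mem_span_singleton_self t)
      obtain ⟨b, hb⟩ := Ideal.mem_span_singleton.mp hpow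
      obtain ⟨b, rfl⟩ := Ideal.Quotient.mk_surjective b
      rw [map_mul, hgc] at hb
      -- Modulo `p` the whole ideal of `g` is generated by `t`, and `c(g)` is `t^a` times a nonzero
      -- constant. In the domain, either `t` vanishes, as wanted, or `w * C r` lies in `m`, which is
      -- excluded.
      have h2 : t ^ a * φ (w * C r - g i₀ * b) = 0 := by
        rw [map_sub, map_mul, map_mul]
        linear_combination hb
      rcases mul_eq_zero.mp h2 with h3 | h3
      · exact Ideal.Quotient.eq_zero_iff_mem.mp (eq_zero_of_pow_eq_zero h3)
      · exfalso
        have h4 := hpm (Ideal.Quotient.eq_zero_iff_mem.mp h3)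
        have h5 : w * C r ∈ m := by
          have := add_mem h4 (m.mul_mem_right b (hJm (Ideal.subset_span ⟨i₀, rfl⟩)))
          simpa using this
        exact (Ideal.IsPrime.mem_or_mem inferInstance h5).elim hw hr
  have h1 := Ideal.height_le_card_of_mem_minimalPrimes_span_finset hmin
  rw [hm, height_point, Nat.card_eq_fintype_card] at h1
  have h2 : S.card ≤ Fintype.card σ - 1 := by
    refine Finset.card_image_le.trans ?_
    simp [Finset.card_erase_of_mem]
  have h3 : 0 < Fintype.card σ := Fintype.card_pos_iff.mpr ⟨i₀⟩
  have h4 : Fintype.card σ ≤ S.card := by exact_mod_cast h1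
  omega

theorem aeval_mem_span_pow {τ R S : Type*} [CommRing R] [CommRing S] [Algebra R S] (g : τ → S)
    {c : MvPolynomial τ R} {a : ℕ} (h : ∀ k < a, homogeneousComponent k c = 0) :
    aeval g c ∈ Ideal.span (Set.range g) ^ a := by
  rw [← sum_homogeneousComponent c, map_sum]
  refine Ideal.sum_mem _ fun k _ => ?_
  by_cases hk : k < a
  · simp [h k hk]
  · refine Ideal.pow_le_pow_right (not_lt.mp hk) ?_
    rw [Ideal.mem_span_pow_iff_exists_isHomogeneous]
    refine ⟨map (algebraMap R S) (homogeneousComponent k c),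
      (homogeneousComponent_isHomogeneous k c).map _, ?_⟩
    rw [aeval_def, eval₂_eq_eval_map]

/-- Polynomials separating isolated zeros `v j` of `g` to a high order are linearly independent
over the subring generated by `g`. -/
theorem exists_independent [Finite σ] {ι : Type*} [Fintype ι] {g : σ → MvPolynomial σ L}
    {v : ι → σ → L} (hinj : Function.Injective v)
    (hv : ∀ j, vanishingIdeal L {v j} ∈ (Ideal.span (Set.range g)).minimalPrimes) :
    ∃ E : ι → MvPolynomial σ L, ∀ c : ι → MvPolynomial σ L,
      ∑ j, aeval g (c j) * E j = 0 → c = 0 := by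
  classical
  set J := Ideal.span (Set.range g)
  -- `x i k` vanishes at `v k` to such an order that it falls into `J` after multiplication by `y i
  -- k`, a unit at `v k`; it does not vanish at `v i`.
  have hsep : ∀ i k : ι, ∃ x y : MvPolynomial σ L, i ≠ k →
      eval (v i) x ≠ 0 ∧ eval (v k) y ≠ 0 ∧ y * x ∈ J := by
    intro i k
    by_cases hik : i = k
    · exact ⟨0, 0, fun h => absurd hik h⟩
    obtain ⟨s, hs⟩ := Function.ne_iff.mp (hinj.ne hik)
    obtain ⟨y, hy, m, hm⟩ := exists_mul_pow_mem_of_mem_minimalPrimes (hv k)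
      (x := X s - C (v k s)) (by rw [mem_point]; simp)
    refine ⟨(X s - C (v k s)) ^ m, y, fun _ => ⟨?_, ?_, hm⟩⟩
    · rw [map_pow]
      refine pow_ne_zero _ ?_
      simpa [sub_eq_zero] using hs
    · rwa [mem_point] at hy
  choose x y hxy using hsep
  refine ⟨fun i => ∏ k ∈ Finset.univ.erase i, x i k, fun c hc => ?_⟩
  by_contra hc0
  have hex : ∃ a, ∃ j, homogeneousComponent a (c j) ≠ 0 := by
    obtain ⟨j, hj⟩ := Function.ne_iff.mp hc0
    by_contra! h
    apply hj
    rw [← sum_homogeneousComponent (c j)]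
    exact Finset.sum_eq_zero fun a _ => h a j
  obtain ⟨j, hj⟩ := Nat.find_spec hex
  -- `a` is the lowest degree occurring in any coefficient. Multiplying the relation by `s` moves
  -- the terms with `i ≠ j` into `J^a * J`, so the degree `a` part of `c j` would contradict
  -- `quasiRegular`.
  set a := Nat.find hex
  have hlow : ∀ i, ∀ k < a, homogeneousComponent k (c i) = 0 := fun i k hk => by
    have := Nat.find_min hex hk
    push Not at this
    exact this i
  set s := ∏ i ∈ Finset.univ.erase j, y i j
  set E : ι → MvPolynomial σ L := fun i => ∏ k ∈ Finset.univ.erase i, x i k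
  have hw : s * E j ∉ vanishingIdeal L ({v j} : Set (σ → L)) := by
    rw [mem_point, map_mul, map_prod, map_prod]
    refine mul_ne_zero (Finset.prod_ne_zero_iff.mpr fun i hi => ?_)
      (Finset.prod_ne_zero_iff.mpr fun k hk => ?_)
    · exact (hxy i j (Finset.ne_of_mem_erase hi)).2.1
    · exact (hxy j k (Finset.ne_of_mem_erase hk).symm).1
  have hsE : ∀ i ≠ j, s * E i ∈ J := fun i hi => by
    obtain ⟨b, hb⟩ : y i j ∣ s := Finset.dvd_prod_of_mem (fun i => y i j) (by simp [hi])
    obtain ⟨b', hb'⟩ : x i j ∣ E i := Finset.dvd_prod_of_mem (fun k => x i k) (by simp [hi.symm])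
    rw [hb, hb', show y i j * b * (x i j * b') = b * b' * (y i j * x i j) by ring]
    exact J.mul_mem_left _ (hxy i j hi).2.2
  refine quasiRegular (hv j) (homogeneousComponent_isHomogeneous a (c j)) hj hw ?_
  have hrest : aeval g (c j - homogeneousComponent a (c j)) ∈ J ^ (a + 1) := by
    refine aeval_mem_span_pow g fun k hk => ?_
    rw [map_sub]
    rcases Nat.lt_succ_iff_lt_or_eq.mp hk with hk | rfl
    · rw [hlow j k hk, homogeneousComponent_of_mem (homogeneousComponent_isHomogeneous a (c j)),
        if_neg hk.ne, sub_zero]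
    · rw [homogeneousComponent_of_mem (homogeneousComponent_isHomogeneous a (c j)), if_pos rfl,
        sub_self]
  rw [← Finset.add_sum_erase _ _ (Finset.mem_univ j)] at hc
  have : s * E j * aeval g (homogeneousComponent a (c j)) =
      -(s * E j * aeval g (c j - homogeneousComponent a (c j))) -
        ∑ i ∈ Finset.univ.erase j, aeval g (c i) * (s * E i) := by
    have h2 : ∑ i ∈ Finset.univ.erase j, aeval g (c i) * (s * E i) =
        s * ∑ i ∈ Finset.univ.erase j, aeval g (c i) * E i := by
      rw [Finset.mul_sum]; exact Finset.sum_congr rfl fun _ _ => by ring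
    rw [h2, map_sub]
    linear_combination s * hc
  rw [this]
  refine sub_mem (neg_mem (Ideal.mul_mem_left _ _ hrest)) (Ideal.sum_mem _ fun i hi => ?_)
  rw [pow_succ]
  exact Ideal.mul_mem_mul (aeval_mem_span_pow g (hlow i)) (hsE i (Finset.ne_of_mem_erase hi))

end QuasiRegular

/-! ### Bézout's inequality by counting monomials -/

section Counting

/-- Iterating the step gives S^k ≤ Δ^k h(kc), where h(kc) grows only polynomially in k; hence S/Δ
cannot exceed 1. This replaces an asymptotic formula for `h`. -/
theorem le_of_forall_mul_le {S Δ c N : ℕ} {h : ℕ → ℕ} (hΔ : 0 < Δ) (h0 : 1 ≤ h 0)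
    (hstep : ∀ T, S * h T ≤ Δ * h (T + c)) (hpoly : ∀ T, h T ≤ (T + 1) ^ N) : S ≤ Δ := by
  by_contra! hlt
  have hind : ∀ k : ℕ, S ^ k ≤ Δ ^ k * h (k * c) := by
    intro k
    induction k with
    | zero => simpa using h0
    | succ k ih =>
      calc S ^ (k + 1) = S * S ^ k := by ring
        _ ≤ S * (Δ ^ k * h (k * c)) := by gcongr
        _ = Δ ^ k * (S * h (k * c)) := by ring
        _ ≤ Δ ^ k * (Δ * h (k * c + c)) := Nat.mul_le_mul_left _ (hstep _)
        _ = Δ ^ (k + 1) * h ((k + 1) * c) := by rw [show (k + 1) * c = k * c + c by ring]; ring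
  have hΔ' : (0 : ℝ) < Δ := by exact_mod_cast hΔ
  set r : ℝ := S / Δ with hr
  have hr1 : 1 < r := by rw [hr, one_lt_div hΔ']; exact_mod_cast hlt
  have hlim := tendsto_pow_const_div_const_pow_of_one_lt N hr1
  have hc : (0 : ℝ) < (1 / (c + 1) ^ N : ℝ) := by positivity
  obtain ⟨k, hk, hk1⟩ :=
    ((hlim.eventually (gt_mem_nhds hc)).and (Filter.eventually_ge_atTop 1)).exists
  have hrk : 0 < r ^ k := by positivity
  have h1 : r ^ k ≤ ((k * c + 1 : ℕ) : ℝ) ^ N := by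
    rw [hr, div_pow, div_le_iff₀ (by positivity)]
    have : S ^ k ≤ (k * c + 1) ^ N * Δ ^ k := by
      rw [mul_comm]
      exact (hind k).trans (Nat.mul_le_mul_left _ (hpoly _))
    exact_mod_cast this
  have h2 : ((k * c + 1 : ℕ) : ℝ) ^ N ≤ (c + 1 : ℝ) ^ N * (k : ℝ) ^ N := by
    rw [← mul_pow]
    have : k * c + 1 ≤ (c + 1) * k := by nlinarith
    gcongr
    exact_mod_cast this
  rw [div_lt_div_iff₀ hrk (by positivity)] at hk
  nlinarith

variable {σ : Type*} [Fintype σ]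

/-- The exponents of weighted degree at most `T`. -/
def weightedExponents (δ : σ → ℕ) (T : ℕ) : Set (σ →₀ ℕ) := {α | ∑ i, α i * δ i ≤ T}

theorem finite_and_ncard_weightedExponents {δ : σ → ℕ} (hδ : ∀ i, 1 ≤ δ i) (T : ℕ) :
    (weightedExponents δ T).Finite ∧
      (weightedExponents δ T).ncard ≤ (T + 1) ^ Fintype.card σ := by
  have hle : ∀ α ∈ weightedExponents δ T, ∀ i, α i < T + 1 := fun α hα i => by
    have h1 : α i * δ i ≤ ∑ i, α i * δ i :=
      Finset.single_le_sum (f := fun i => α i * δ i) (fun _ _ => Nat.zero_le _) (Finset.mem_univ i)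
    have h2 : α i * 1 ≤ α i * δ i := Nat.mul_le_mul_left _ (hδ i)
    have h3 : ∑ i, α i * δ i ≤ T := hα
    omega
  let f : weightedExponents δ T → σ → Fin (T + 1) := fun α i => ⟨α.1 i, hle α.1 α.2 i⟩
  have hf : Function.Injective f := fun α β h => by
    apply Subtype.ext; ext i
    simpa [f] using congrFun h i
  have hfin : Finite (weightedExponents δ T) := Finite.of_injective f hf
  refine ⟨hfin, ?_⟩
  have := Nat.card_le_card_of_injective f hf
  rw [Nat.card_coe_set_eq] at this
  rwa [Nat.card_fun, Nat.card_fin, Nat.card_eq_fintype_card] at this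

/-- Divide each exponent by `δ i` with remainder: there are `∏ δ i` possible remainders, and the
quotients have weighted degree at most `T`. -/
theorem ncard_exponents_le {δ : σ → ℕ} (hδ : ∀ i, 1 ≤ δ i) (T : ℕ) :
    (weightedExponents (fun _ : σ => 1) T).ncard ≤
      (∏ i, δ i) * (weightedExponents δ T).ncard := by
  have := (finite_and_ncard_weightedExponents hδ T).1.to_subtype
  let f : weightedExponents (fun _ : σ => 1) T → ((i : σ) → Fin (δ i)) × weightedExponents δ T :=
    fun β => (fun i => ⟨β.1 i % δ i, Nat.mod_lt _ (hδ i)⟩,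
      ⟨Finsupp.equivFunOnFinite.symm fun i => β.1 i / δ i, by
        have : ∑ i, β.1 i * 1 ≤ T := β.2
        refine le_trans (Finset.sum_le_sum fun i _ => ?_) this
        simpa using Nat.div_mul_le_self (β.1 i) (δ i)⟩)
  have hf : Function.Injective f := fun α β h => by
    apply Subtype.ext; ext i
    have h1 := congrFun (congrArg Prod.fst h) i
    have h2 := congrArg (fun x => x.2.1 i) h
    simp only [f, Fin.mk.injEq, Finsupp.equivFunOnFinite_symm_apply_apply] at h1 h2
    rw [← Nat.div_add_mod (α.1 i) (δ i), h1, h2, Nat.div_add_mod]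
  have := Nat.card_le_card_of_injective f hf
  rw [Nat.card_prod, Nat.card_coe_set_eq, Nat.card_coe_set_eq, Nat.card_pi] at this
  simpa using this

end Counting

section Bezout

variable {L σ : Type*} [Field L]

theorem totalDegree_aeval_le [Fintype σ] {g : σ → MvPolynomial σ L} {δ : σ → ℕ}
    (hg : ∀ i, (g i).totalDegree ≤ δ i) {T : ℕ} {c : MvPolynomial σ L}
    (hc : ↑c.support ⊆ weightedExponents δ T) : (aeval g c).totalDegree ≤ T := by
  rw [aeval_def, eval₂_eq']
  refine totalDegree_finsetSum_le fun d hd => ?_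
  refine (totalDegree_mul _ _).trans ?_
  rw [algebraMap_eq, totalDegree_C, zero_add]
  refine (totalDegree_finsetProd _ _).trans (le_trans (Finset.sum_le_sum fun i _ => ?_) (hc hd))
  exact (totalDegree_pow _ _).trans (Nat.mul_le_mul_left _ (hg i))

/-- **Bézout's inequality** for the isolated zeros of a system of as many equations as unknowns. -/
theorem card_isolated_zeros_le [IsAlgClosed L] [Fintype σ] {ι : Type*} [Fintype ι]
    {g : σ → MvPolynomial σ L} {δ : σ → ℕ} (hδ : ∀ i, 1 ≤ δ i)
    (hg : ∀ i, (g i).totalDegree ≤ δ i) {v : ι → σ → L} (hinj : Function.Injective v)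
    (hv : ∀ j, vanishingIdeal L {v j} ∈ (Ideal.span (Set.range g)).minimalPrimes) :
    Fintype.card ι ≤ ∏ i, δ i := by
  classical
  obtain ⟨E, hE⟩ := exists_independent hinj hv
  set c := Finset.univ.sup fun j => (E j).totalDegree
  refine le_of_forall_mul_le (c := c) (N := Fintype.card σ)
    (h := fun T => (weightedExponents δ T).ncard) (Finset.prod_pos fun i _ => hδ i) ?_ ?_
    fun T => (finite_and_ncard_weightedExponents hδ T).2
  · rw [Nat.succ_le_iff, Set.ncard_pos (finite_and_ncard_weightedExponents hδ 0).1]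
    exact ⟨0, by simp [weightedExponents]⟩
  · intro T
    refine le_trans ?_ (ncard_exponents_le hδ (T + c))
    let W := restrictSupport L (weightedExponents δ T)
    let V := restrictSupport L (weightedExponents (fun _ : σ => 1) (T + c))
    have hfinW := (finite_and_ncard_weightedExponents hδ T).1.to_subtype
    have hfinV := (finite_and_ncard_weightedExponents (fun _ : σ => le_refl 1) (T + c)).1.to_subtype
    let bW : Module.Basis _ L W := basisRestrictSupport L (weightedExponents δ T)
    let bV : Module.Basis _ L V := basisRestrictSupport L (weightedExponents (fun _ : σ => 1) (T + c))
    have hW : Module.finrank L W = (weightedExponents δ T).ncard := by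
      rw [Module.finrank_eq_nat_card_basis bW, Nat.card_coe_set_eq]
    have hV : Module.finrank L V = (weightedExponents (fun _ : σ => 1) (T + c)).ncard := by
      rw [Module.finrank_eq_nat_card_basis bV, Nat.card_coe_set_eq]
    have := Module.Finite.of_basis bW
    have := Module.Finite.of_basis bV
    -- Independence of the `E j` makes this map injective. Its source has dimension `card ι` times
    -- the number of weighted exponents, and its values have degree at most `T + c`.
    let Φ : (ι → W) →ₗ[L] MvPolynomial σ L :=
      ∑ j, (LinearMap.mulRight L (E j)) ∘ₗ (aeval g).toLinearMap ∘ₗ W.subtype ∘ₗ LinearMap.proj j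
    have hΦ : ∀ w, Φ w = ∑ j, aeval g (w j : MvPolynomial σ L) * E j := fun w => by
      simp [Φ]
    have hΦV : ∀ w, Φ w ∈ V := fun w => by
      rw [hΦ]
      have hdeg : (∑ j, aeval g (w j : MvPolynomial σ L) * E j).totalDegree ≤ T + c := by
        refine totalDegree_finsetSum_le fun j _ => (totalDegree_mul _ _).trans ?_
        exact add_le_add (totalDegree_aeval_le hg ((mem_restrictSupport_iff L).mp (w j).2))
          (Finset.le_sup (f := fun j => (E j).totalDegree) (Finset.mem_univ j))
      rw [mem_restrictSupport_iff]
      intro d hd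
      have := (le_totalDegree hd).trans hdeg
      rw [Finsupp.sum_fintype _ _ (fun _ => rfl)] at this
      simpa [weightedExponents] using this
    have hinjΦ : Function.Injective (Φ.codRestrict V hΦV) := by
      rw [← LinearMap.ker_eq_bot, LinearMap.ker_codRestrict, LinearMap.ker_eq_bot']
      intro w hw
      rw [hΦ] at hw
      funext j
      exact Subtype.ext (congrFun (hE (fun j => w j) hw) j)
    have := LinearMap.finrank_le_finrank_of_injective hinjΦ
    rw [Module.finrank_pi_fintype, hV] at this
    simpa [hW] using this

end Bezout

/-! ### Local dimension by chains of primes, and cutting it down by general combinations -/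

section ChainDim

variable {α : Type*} [PartialOrder α]

/-- The supremum of the lengths of the chains of elements of `S` between `p` and `m`. -/
noncomputable def chainDim (S : Set α) (p m : α) : WithBot ℕ∞ :=
  Order.krullDim {q : α // q ∈ S ∧ p ≤ q ∧ q ≤ m}

theorem chainDim_anti (S : Set α) {p p' : α} (h : p ≤ p') (m : α) :
    chainDim S p' m ≤ chainDim S p m :=
  Order.krullDim_le_of_strictMono
    (fun q : {q : α // q ∈ S ∧ p' ≤ q ∧ q ≤ m} => ⟨q.1, q.2.1, h.trans q.2.2.1, q.2.2.2⟩)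
    fun _ _ hab => hab

/-- Any chain starting at or above `p'` can be prolonged downwards by `p`. -/
theorem chainDim_le_of_lt {S : Set α} {p p' m : α} (hp : p ∈ S) (h : p < p') {k : ℕ}
    (hk : chainDim S p m ≤ (k + 1 : ℕ)) : chainDim S p' m ≤ k := by
  refine iSup_le fun s => ?_
  have hhead := s.head.2
  let F : {q : α // q ∈ S ∧ p' ≤ q ∧ q ≤ m} → {q : α // q ∈ S ∧ p ≤ q ∧ q ≤ m} :=
    fun q => ⟨q.1, q.2.1, h.le.trans q.2.2.1, q.2.2.2⟩
  let s' : LTSeries {q : α // q ∈ S ∧ p ≤ q ∧ q ≤ m} := s.map F fun _ _ hab => hab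
  have hs' : s'.head = F s.head := s.head_map F fun _ _ hab => hab
  have hlt : (⟨p, hp, le_rfl, h.le.trans (hhead.2.1.trans hhead.2.2)⟩ :
      {q : α // q ∈ S ∧ p ≤ q ∧ q ≤ m}) < s'.head := by
    rw [hs']; exact h.trans_le hhead.2.1
  have ht : ((s'.cons _ hlt).length : WithBot ℕ∞) ≤ (k + 1 : ℕ) :=
    (Order.LTSeries.length_le_krullDim _).trans hk
  have ht' : (s'.cons _ hlt).length = s.length + 1 := by
    rw [RelSeries.cons_length]; rfl
  rw [ht'] at ht
  have : s.length + 1 ≤ k + 1 := by exact_mod_cast ht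
  exact_mod_cast Nat.le_of_succ_le_succ this

theorem eq_of_chainDim_le_zero {S : Set α} {p m : α} (hp : p ∈ S) (hm : m ∈ S) (h : p ≤ m)
    (hk : chainDim S p m ≤ (0 : ℕ)) : p = m := by
  have hmax := Order.krullDim_nonpos_iff_forall_isMax.mp hk ⟨p, hp, le_rfl, h⟩
  exact le_antisymm h (hmax (b := ⟨m, hm, h, le_rfl⟩) h)

theorem chainDim_self_le (S : Set α) (m : α) : chainDim S m m ≤ (0 : ℕ) := by
  have : Subsingleton {q : α // q ∈ S ∧ m ≤ q ∧ q ≤ m} :=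
    ⟨fun a b => Subtype.ext
      ((le_antisymm a.2.2.2 a.2.2.1).trans (le_antisymm b.2.2.2 b.2.2.1).symm)⟩
  exact Order.krullDim_nonpos_of_subsingleton

end ChainDim

section Avoidance

/-- A vector space over an infinite field is not a finite union of proper subspaces. Including the
coordinate hyperplanes among them makes all coefficients nonzero, which lets `exists_cut_equations`
eliminate any chosen equation. -/
theorem exists_linearCombination_notMem {K A ι : Type*} [Field K] [Infinite K] [CommRing A]
    [Algebra K A] [Fintype ι] (φ : ι → A) {P : Set (Ideal A)} (hP : P.Finite)
    (h : ∀ p ∈ P, ∃ i, φ i ∉ p) :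
    ∃ c : ι → K, (∀ i, c i ≠ 0) ∧ ∀ p ∈ P, ∑ i, c i • φ i ∉ p := by
  classical
  have := hP.to_subtype
  let Λ : (ι → K) →ₗ[K] A := Fintype.linearCombination K φ
  obtain ⟨c, hc⟩ := Submodule.exists_forall_notMem_of_forall_ne_top (K := K) (M := ι → K)
    (fun x : ι ⊕ P => x.elim (fun i => LinearMap.ker (LinearMap.proj i : (ι → K) →ₗ[K] K))
      fun p => (p.1.restrictScalars K).comap Λ) (by
    rintro (i | ⟨p, hp⟩) htop
    · have : (Pi.single i 1 : ι → K) ∈ LinearMap.ker (LinearMap.proj i : (ι → K) →ₗ[K] K) := by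
        simp only [Sum.elim_inl] at htop; rw [htop]; trivial
      simp at this
    · obtain ⟨i, hi⟩ := h p hp
      have : (Pi.single i 1 : ι → K) ∈ (p.restrictScalars K).comap Λ := by
        simp only [Sum.elim_inr] at htop; rw [htop]; trivial
      apply hi
      simpa [Λ] using this)
  refine ⟨c, fun i => by simpa using hc (Sum.inl i), fun p hp => ?_⟩
  simpa [Λ, Fintype.linearCombination_apply] using hc (Sum.inr ⟨p, hp⟩)

end Avoidance

section Cutting

variable {L σ : Type*} [Field L] [Infinite L] [Finite σ]

/-- Cutting down by linear combinations of a family `h`, within a set `S` of primes that contains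
the minimal primes of all ideals satisfying `H`. -/
theorem exists_cut_to_points {ι : Type*} [Fintype ι] (h : ι → MvPolynomial σ L)
    {S M : Set (Ideal (MvPolynomial σ L))} {H : Ideal (MvPolynomial σ L) → Prop}
    (hS : ∀ p ∈ S, p.IsPrime) (hHS : ∀ J, H J → ∀ p ∈ J.minimalPrimes, p ∈ S)
    (hH : ∀ J, H J → ∀ x ∈ Submodule.span L (Set.range h), H (J ⊔ Ideal.span {x}))
    (hM : M ⊆ S) (hmax : ∀ p ∈ S, (∀ i, h i ∈ p) → ∀ m ∈ M, p ≤ m → p = m) (k : ℕ) :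
    ∀ J : Ideal (MvPolynomial σ L), H J →
      (∀ m ∈ M, ∀ p ∈ S, J ≤ p → p ≤ m → chainDim S p m ≤ k) →
      ∃ g : Fin k → MvPolynomial σ L, (∀ i, g i ∈ Submodule.span L (Set.range h)) ∧
        H (J ⊔ Ideal.span (Set.range g)) ∧
        ∀ m ∈ M, ∀ p ∈ S, J ⊔ Ideal.span (Set.range g) ≤ p → p ≤ m → p = m := by
  induction k with
  | zero =>
    intro J hHJ hJ
    refine ⟨Fin.elim0, fun i => i.elim0, by simpa using hHJ, fun m hm p hp hJp hpm => ?_⟩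
    exact eq_of_chainDim_le_zero hp (hM hm) hpm (hJ m hm p hp (le_sup_left.trans hJp) hpm)
  | succ k ih =>
    intro J hHJ hJ
    -- The new element avoids every component of `J` not contained in the zeros of `h`, so the
    -- dimension drops there; the other components through a point of `M` are already that point, by
    -- `hmax`.
    obtain ⟨c, -, hc⟩ := exists_linearCombination_notMem (K := L) h
      (P := {p ∈ J.minimalPrimes | ∃ i, h i ∉ p})
      ((J.finite_minimalPrimes_of_isNoetherianRing).subset fun p hp => hp.1) fun p hp => hp.2
    set g₀ := ∑ i, c i • h i with hg₀
    have hg₀h : g₀ ∈ Submodule.span L (Set.range h) :=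
      Submodule.sum_mem _ fun i _ => Submodule.smul_mem _ _ (Submodule.subset_span ⟨i, rfl⟩)
    obtain ⟨g, hg, hgH, hgM⟩ := ih (J ⊔ Ideal.span {g₀}) (hH J hHJ g₀ hg₀h) (by
      intro m hm p hp hJp hpm
      have := hS p hp
      obtain ⟨p₀, hp₀, hp₀p⟩ := Ideal.exists_minimalPrimes_le (le_sup_left.trans hJp)
      have hp₀S := hHS J hHJ p₀ hp₀
      by_cases hall : ∃ i, h i ∉ p₀
      · refine chainDim_le_of_lt (p := p₀) hp₀S (lt_of_le_of_ne hp₀p ?_)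
          (hJ m hm p₀ hp₀S hp₀.1.2 (hp₀p.trans hpm))
        rintro rfl
        exact hc p₀ ⟨hp₀, hall⟩ (hJp (Ideal.mem_sup_right (Ideal.mem_span_singleton_self _)))
      · push Not at hall
        have h1 : p₀ = m := hmax p₀ hp₀S hall m hm (hp₀p.trans hpm)
        have h2 : p = m := le_antisymm hpm (h1 ▸ hp₀p)
        rw [h2]
        exact (chainDim_self_le _ m).trans (by exact_mod_cast Nat.zero_le k))
    have hcons : J ⊔ Ideal.span (Set.range (Fin.cons g₀ g : Fin (k + 1) → MvPolynomial σ L)) =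
        J ⊔ Ideal.span {g₀} ⊔ Ideal.span (Set.range g) := by
      rw [Fin.range_cons, Set.insert_eq, Ideal.span_union, ← sup_assoc]
    refine ⟨Fin.cons g₀ g, fun i => ?_, hcons ▸ hgH, hcons ▸ hgM⟩
    exact Fin.cases hg₀h (fun i => by simpa using hg i) i

/-- Cutting down by linear combinations of the equations `f`, using each equation as a leading
term at most once. -/
theorem exists_cut_equations {κ : Type*} [Fintype κ] (f : κ → MvPolynomial σ L) {δ : κ → ℕ}
    (hδ : ∀ i, 1 ≤ δ i) (hf : ∀ i, (f i).totalDegree ≤ δ i)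
    {M : Set (Ideal (MvPolynomial σ L))} {r : ℕ}
    (hM : ∀ m ∈ M, chainDim {q : Ideal (MvPolynomial σ L) | q.IsPrime}
      (Ideal.span (Set.range f)) m ≤ r) (k : ℕ) :
    ∀ (s : Finset κ) (J : Ideal (MvPolynomial σ L)),
      Ideal.span (Set.range f) ≤ J ⊔ Ideal.span (f '' s) →
      (∀ m ∈ M, ∀ p : Ideal (MvPolynomial σ L), p.IsPrime → J ≤ p → p ≤ m →
        Ideal.span (Set.range f) ≤ p ∨ chainDim {q | q.IsPrime} p m ≤ (r + k : ℕ)) →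
      ∃ (g : Fin k → MvPolynomial σ L) (ε : Fin k → ℕ), (∀ i, 1 ≤ ε i) ∧
        (∀ i, (g i).totalDegree ≤ ε i) ∧ ∏ i, ε i ≤ ∏ i ∈ s, δ i ∧
        (∀ i, g i ∈ Ideal.span (Set.range f)) ∧
        ∀ m ∈ M, ∀ p : Ideal (MvPolynomial σ L), p.IsPrime →
          J ⊔ Ideal.span (Set.range g) ≤ p → p ≤ m → chainDim {q | q.IsPrime} p m ≤ r := by
  classical
  have hgood : ∀ m ∈ M, ∀ p : Ideal (MvPolynomial σ L), Ideal.span (Set.range f) ≤ p →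
      chainDim {q | q.IsPrime} p m ≤ r := fun m hm p hp =>
    (chainDim_anti _ hp m).trans (hM m hm)
  induction k with
  | zero =>
    intro s J hs hJ
    refine ⟨Fin.elim0, Fin.elim0, fun i => i.elim0, fun i => i.elim0, ?_, fun i => i.elim0,
      fun m hm p hp hJp hpm => ?_⟩
    · simpa using Finset.one_le_prod' fun i _ => hδ i
    · exact (hJ m hm p hp (le_sup_left.trans hJp) hpm).elim (hgood m hm p) id
  | succ k ih =>
    intro s J hs hJ
    rcases s.eq_empty_or_nonempty with rfl | hne
    -- All equations already lie in `J`; the remaining places are filled with the zero polynomial,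
    -- given the degree bound 1.
    · refine ⟨0, 1, fun i => le_rfl, fun i => by simp, by simp, fun i => zero_mem _,
        fun m hm p hp hJp hpm => hgood m hm p ?_⟩
      refine hs.trans ?_
      simpa using le_sup_left.trans hJp
    -- The combination has degree at most the largest `δ i`. As the coefficient of `f i` is nonzero,
    -- `f i` is recovered from it and the others, so `i` is discarded and the product of the degrees
    -- stays below `∏ δ`.
    obtain ⟨i, his, hi⟩ := Finset.exists_max_image s δ hne
    obtain ⟨c, hc0, hc⟩ := exists_linearCombination_notMem (K := L) (fun j : s => f j)
      (P := {p ∈ J.minimalPrimes | ¬ Ideal.span (Set.range f) ≤ p})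
      ((J.finite_minimalPrimes_of_isNoetherianRing).subset fun p hp => hp.1) (by
        rintro p ⟨hp, hfp⟩
        by_contra! hall
        refine hfp (hs.trans (sup_le hp.1.2 (Ideal.span_le.mpr ?_)))
        rintro _ ⟨j, hj, rfl⟩
        exact hall ⟨j, hj⟩)
    set g₀ := ∑ j : s, c j • f j with hg₀
    obtain ⟨g, ε, hε, hgε, hprod, hgf, hgM⟩ := ih (s.erase i) (J ⊔ Ideal.span {g₀}) (by
      refine hs.trans (sup_le (le_sup_left.trans le_sup_left) (Ideal.span_le.mpr ?_))
      have hother : ∀ j ∈ s, j ≠ i →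
          f j ∈ J ⊔ Ideal.span {g₀} ⊔ Ideal.span (f '' (s.erase i : Finset κ)) := fun j hj hji =>
        Ideal.mem_sup_right (Ideal.subset_span ⟨j, by simp [hj, hji], rfl⟩)
      rintro _ ⟨j, hj, rfl⟩
      by_cases hji : j = i
      · subst hji
        have h1 : f j = C (c ⟨j, hj⟩)⁻¹ *
            (g₀ - ∑ l ∈ Finset.univ.erase (⟨j, hj⟩ : s), c l • f l) := by
          rw [hg₀, ← Finset.add_sum_erase _ _ (Finset.mem_univ (⟨j, hj⟩ : s)), add_sub_cancel_right,
            smul_eq_C_mul, ← mul_assoc, ← C_mul, inv_mul_cancel₀ (hc0 _), C_1, one_mul]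
        rw [h1]
        refine Ideal.mul_mem_left _ _ (sub_mem ?_ (Ideal.sum_mem _ fun l hl => ?_))
        · exact Ideal.mem_sup_left (Ideal.mem_sup_right (Ideal.mem_span_singleton_self _))
        · rw [smul_eq_C_mul]
          exact Ideal.mul_mem_left _ _ (hother l l.2 fun h =>
            Finset.ne_of_mem_erase hl (Subtype.ext h))
      · exact hother j hj hji) (by
      intro m hm p hp hJp hpm
      obtain ⟨p₀, hp₀, hp₀p⟩ := Ideal.exists_minimalPrimes_le (le_sup_left.trans hJp)
      by_cases hfp : Ideal.span (Set.range f) ≤ p₀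
      · exact Or.inl (hfp.trans hp₀p)
      · refine Or.inr (chainDim_le_of_lt (p := p₀) hp₀.1.1 (lt_of_le_of_ne hp₀p ?_)
          ((hJ m hm p₀ hp₀.1.1 hp₀.1.2 (hp₀p.trans hpm)).resolve_left hfp))
        rintro rfl
        exact hc p₀ ⟨hp₀, hfp⟩ (hJp (Ideal.mem_sup_right (Ideal.mem_span_singleton_self _))))
    refine ⟨Fin.cons g₀ g, Fin.cons (δ i) ε, fun j => ?_, fun j => ?_, ?_, fun j => ?_,
      fun m hm p hp hJp hpm => hgM m hm p hp ?_ hpm⟩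
    · exact Fin.cases (hδ i) (fun j => by simpa using hε j) j
    · refine Fin.cases ?_ (fun j => by simpa using hgε j) j
      refine totalDegree_finsetSum_le fun l _ => (totalDegree_smul_le _ _).trans ?_
      exact (hf l).trans (hi l l.2)
    · rw [Fin.prod_cons, ← Finset.mul_prod_erase s δ his]
      exact Nat.mul_le_mul_left _ hprod
    · refine Fin.cases ?_ (fun j => by simpa using hgf j) j
      refine Ideal.sum_mem _ fun l _ => ?_
      rw [smul_eq_C_mul]
      exact Ideal.mul_mem_left _ _ (Ideal.subset_span ⟨l, rfl⟩)
    · rwa [Fin.range_cons, Set.insert_eq, Ideal.span_union, ← sup_assoc] at hJp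

end Cutting

/-! ### Points with coordinates in a finite set -/

section PointCount

variable {L σ : Type*} [Field L]

theorem point_le {v : σ → L} {p : Ideal (MvPolynomial σ L)} (h : ∀ i, X i - C (v i) ∈ p) :
    vanishingIdeal L {v} ≤ p := by
  intro F hF
  rw [mem_point] at hF
  have hom : Ideal.Quotient.mk p = ((Ideal.Quotient.mk p).comp C).comp (eval v) := by
    ext i
    · simp
    · simp only [RingHom.comp_apply, eval_X]
      exact Ideal.Quotient.eq.mpr (h i)
  have : Ideal.Quotient.mk p F = Ideal.Quotient.mk p (C (eval v F)) := congrArg (fun f => f F) hom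
  rw [hF, C_0, map_zero] at this
  exact Ideal.Quotient.eq_zero_iff_mem.mp this

/-- A prime containing these products contains one linear factor for each variable, so it is the
ideal of a point. -/
theorem isMaximal_of_forall_prod_mem (T : Finset L) {p : Ideal (MvPolynomial σ L)} (hp : p.IsPrime)
    (h : ∀ i, ∏ c ∈ T, (X i - C c) ∈ p) : p.IsMaximal := by
  have h1 : ∀ i, ∃ c, (X i - C c : MvPolynomial σ L) ∈ p := fun i => by
    obtain ⟨c, -, hc⟩ := (Ideal.IsPrime.prod_mem_iff).mp (h i)
    exact ⟨c, hc⟩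
  choose c hc using h1
  rw [← (point_isMaximal c).eq_of_le hp.ne_top (point_le hc)]
  infer_instance

variable [Fintype σ]

theorem chainDim_le_card (p m : Ideal (MvPolynomial σ L)) :
    chainDim {q : Ideal (MvPolynomial σ L) | q.IsPrime} p m ≤ (Fintype.card σ : ℕ) := by
  have hdim : ringKrullDim (MvPolynomial σ L) = (Fintype.card σ : ℕ) := by simp
  rw [← hdim]
  exact Order.krullDim_le_of_strictMono
    (fun q : {q : Ideal (MvPolynomial σ L) // q ∈ {q : Ideal (MvPolynomial σ L) | q.IsPrime} ∧
      p ≤ q ∧ q ≤ m} => (⟨q.1, q.2.1⟩ : PrimeSpectrum (MvPolynomial σ L))) fun _ _ hab => hab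

/-- The number of points with coordinates in a finite set `T` of an affine algebraic set whose
local dimension at these points is at most `r`. -/
theorem card_points_le [IsAlgClosed L] {κ : Type*} [Fintype κ] {f : κ → MvPolynomial σ L} {δ : κ → ℕ}
    (hδ : ∀ i, 1 ≤ δ i) (hf : ∀ i, (f i).totalDegree ≤ δ i) {T : Finset L} (hT : T.Nonempty)
    {ι : Type*} [Fintype ι] {v : ι → σ → L} (hinj : Function.Injective v)
    (hvT : ∀ j i, v j i ∈ T) (hvf : ∀ j k, eval (v j) (f k) = 0) {r : ℕ}
    (hr : ∀ j, chainDim {q : Ideal (MvPolynomial σ L) | q.IsPrime}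
      (Ideal.span (Set.range f)) (vanishingIdeal L {v j}) ≤ r) :
    Fintype.card ι ≤ (∏ k, δ k) * T.card ^ r := by
  classical
  wlog hrN : r ≤ Fintype.card σ generalizing r
  · exact (this (fun j => chainDim_le_card _ _) le_rfl).trans
      (Nat.mul_le_mul_left _ (Nat.pow_le_pow_right hT.card_pos (not_le.mp hrN).le))
  obtain ⟨k, hk⟩ := Nat.exists_eq_add_of_le hrN
  set M : Set (Ideal (MvPolynomial σ L)) := Set.range fun j => vanishingIdeal L {v j} with hMdef
  have hM : ∀ m ∈ M, m.IsPrime := by rintro _ ⟨j, rfl⟩; infer_instance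
  have hIm : ∀ j, Ideal.span (Set.range f) ≤ vanishingIdeal L {v j} := fun j => by
    rw [Ideal.span_le]
    rintro _ ⟨k, rfl⟩
    exact mem_point.mpr (hvf j k)
  obtain ⟨g, ε, hε, hgε, hprod, hgf, hgM⟩ := exists_cut_equations f hδ hf (M := M) (r := r)
    (by rintro _ ⟨j, rfl⟩; exact hr j) k Finset.univ ⊥
    (by simp) (fun m _ p _ _ _ => Or.inr (hk ▸ chainDim_le_card p m))
  rw [bot_sup_eq] at hgM
  -- The grid polynomials vanish at all the counted points, and their common zeros are points only;
  -- `r` combinations of them isolate every counted point.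
  obtain ⟨g', hg', -, hgM'⟩ := exists_cut_to_points (fun i : σ => ∏ c ∈ T, (X i - C c))
    (S := {q | q.IsPrime}) (H := fun _ => True) (fun _ hp => hp) (fun _ _ p hp => hp.1.1)
    (fun _ _ _ _ => trivial) hM
    (fun p hp h m hm hpm => (isMaximal_of_forall_prod_mem T hp h).eq_of_le (hM m hm).ne_top hpm)
    r _ trivial hgM
  have hcard : Fintype.card σ = Fintype.card (Fin k ⊕ Fin r) := by
    simp [hk, add_comm]
  let eqv : σ ≃ Fin k ⊕ Fin r := Fintype.equivOfCardEq hcard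
  have hrange : Ideal.span (Set.range (Sum.elim g g' ∘ eqv)) =
      Ideal.span (Set.range g) ⊔ Ideal.span (Set.range g') := by
    rw [eqv.surjective.range_comp, Set.Sum.elim_range, Ideal.span_union]
  have := card_isolated_zeros_le (g := Sum.elim g g' ∘ eqv)
    (δ := Sum.elim ε (fun _ => T.card) ∘ eqv) ?_ ?_ hinj ?_
  · refine this.trans ?_
    rw [Function.comp_def, eqv.prod_comp (Sum.elim ε fun _ => T.card), Fintype.prod_sum_type]
    simpa using Nat.mul_le_mul_right _ hprod
  · intro i
    rcases h : eqv i with j | j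
    · simpa [h] using hε j
    · simpa [h] using hT.card_pos
  · intro i
    rcases h : eqv i with j | j
    · simpa [h] using hgε j
    · simp only [Function.comp_apply, h, Sum.elim_inr]
      refine Submodule.span_induction (p := fun x _ => totalDegree x ≤ T.card) ?_ ?_ ?_ ?_ (hg' j)
      · rintro _ ⟨i, rfl⟩
        refine (totalDegree_finsetProd _ _).trans ?_
        refine (Finset.sum_le_card_nsmul T _ 1 fun c _ => ?_).trans (by simp)
        exact (totalDegree_sub_C_le _ _).trans (totalDegree_X i).le
      · simp
      · exact fun x y _ _ hx hy => (totalDegree_add _ _).trans (max_le hx hy)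
      · exact fun a x _ hx => (totalDegree_smul_le _ _).trans hx
  · intro j
    rw [hrange]
    refine ⟨⟨inferInstance, sup_le ?_ ?_⟩, fun p hp hpm => ?_⟩
    · rw [Ideal.span_le]
      rintro _ ⟨i, rfl⟩
      exact hIm j (hgf i)
    · rw [Ideal.span_le]
      rintro _ ⟨i, rfl⟩
      have : Submodule.span L (Set.range fun i : σ => ∏ c ∈ T, (X i - C c)) ≤
          (vanishingIdeal L {v j}).restrictScalars L := by
        rw [Submodule.span_le]
        rintro _ ⟨i, rfl⟩
        simp only [Submodule.coe_restrictScalars, SetLike.mem_coe, mem_point, map_prod]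
        exact Finset.prod_eq_zero (hvT j i) (by simp)
      exact this (hg' i)
    · exact (hgM' _ ⟨j, rfl⟩ p hp.1 hp.2 hpm).ge

end PointCount

/-! ### Homogeneous primes and affine cones -/

section Homogeneous

attribute [local instance] MvPolynomial.gradedAlgebra

variable {L σ : Type*} [Field L]

/-- Homogeneous ideals of a polynomial ring with its standard grading. -/
abbrev IsHomog (I : Ideal (MvPolynomial σ L)) : Prop :=
  I.IsHomogeneous (homogeneousSubmodule σ L)

/-- The homogeneous core of `p` is prime and still contains `J`, so minimality forces it to be `p`.
-/
theorem isHomog_of_mem_minimalPrimes {J p : Ideal (MvPolynomial σ L)} (hJ : IsHomog J)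
    (hp : p ∈ J.minimalPrimes) : IsHomog p := by
  have hcore : (p.homogeneousCore (homogeneousSubmodule σ L)).toIdeal.IsPrime :=
    Ideal.IsPrime.homogeneousCore hp.1.1
  have hle : J ≤ (p.homogeneousCore (homogeneousSubmodule σ L)).toIdeal := by
    rw [← hJ.toIdeal_homogeneousCore_eq_self]
    exact Ideal.homogeneousCore_mono _ hp.1.2
  have heq := le_antisymm (Ideal.toIdeal_homogeneousCore_le _ p)
    (hp.2 ⟨hcore, hle⟩ (Ideal.toIdeal_homogeneousCore_le _ p))
  rw [IsHomog, ← heq]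
  exact HomogeneousIdeal.isHomogeneous _

theorem isHomog_span {s : Set (MvPolynomial σ L)} (h : ∀ x ∈ s, ∃ a, x.IsHomogeneous a) :
    IsHomog (Ideal.span s) :=
  Ideal.homogeneous_span _ _ fun x hx => h x hx

/-- The homogeneous prime ideal of the line through `v`. -/
noncomputable def lineIdeal (v : σ → L) : Ideal (MvPolynomial σ L) :=
  ((vanishingIdeal L ({v} : Set (σ → L))).homogeneousCore (homogeneousSubmodule σ L)).toIdeal

instance lineIdeal_isPrime (v : σ → L) : (lineIdeal v).IsPrime :=
  Ideal.IsPrime.homogeneousCore inferInstance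

theorem isHomog_lineIdeal (v : σ → L) : IsHomog (lineIdeal v) :=
  HomogeneousIdeal.isHomogeneous _

theorem lineIdeal_le (v : σ → L) : lineIdeal v ≤ vanishingIdeal L {v} :=
  Ideal.toIdeal_homogeneousCore_le _ _

theorem le_lineIdeal_iff {J : Ideal (MvPolynomial σ L)} (hJ : IsHomog J) {v : σ → L} :
    J ≤ lineIdeal v ↔ J ≤ vanishingIdeal L {v} := by
  refine ⟨fun h => h.trans (lineIdeal_le v), fun h => ?_⟩
  rw [← hJ.toIdeal_homogeneousCore_eq_self]
  exact Ideal.homogeneousCore_mono _ h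

theorem mem_lineIdeal {F : MvPolynomial σ L} {a : ℕ} (hF : F.IsHomogeneous a) {v : σ → L} :
    F ∈ lineIdeal v ↔ eval v F = 0 := by
  rw [← mem_point]
  exact ⟨fun h => lineIdeal_le v h,
    fun h => Ideal.mem_homogeneousCore_of_homogeneous_of_mem ⟨a, hF⟩ h⟩

/-- Modulo `p` each variable is `v i` times `ℓ`, so a form of degree a becomes ℓ^a times its value
at `v`. -/
theorem lineIdeal_le_of_mem {v : σ → L} {ℓ : MvPolynomial σ L} {p : Ideal (MvPolynomial σ L)}
    (h : ∀ i, X i - C (v i) * ℓ ∈ p) : lineIdeal v ≤ p := by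
  intro F hF
  rw [← sum_homogeneousComponent F]
  refine Ideal.sum_mem _ fun a _ => ?_
  have hFa : eval v (homogeneousComponent a F) = 0 := by
    rw [← mem_lineIdeal (homogeneousComponent_isHomogeneous a F)]
    exact homogeneousComponent_mem_of_mem (isHomog_lineIdeal v) hF a
  set φ := Ideal.Quotient.mk p
  have hom1 : φ = (eval fun i => φ ℓ * φ (C (v i))).comp (map (φ.comp C)) := by
    ext i
    · simp
    · simp only [RingHom.comp_apply, map_X, eval_X, ← map_mul]
      rw [mul_comm]
      exact Ideal.Quotient.eq.mpr (h i)
  have hom2 : (eval fun i => φ (C (v i))).comp (map (φ.comp C)) = (φ.comp C).comp (eval v) := by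
    ext i <;> simp
  have h1 : φ (homogeneousComponent a F) =
      eval (fun i => φ ℓ * φ (C (v i))) (map (φ.comp C) (homogeneousComponent a F)) :=
    congrArg (fun f => f (homogeneousComponent a F)) hom1
  have h2 : eval (fun i => φ (C (v i))) (map (φ.comp C) (homogeneousComponent a F)) =
      φ (C (eval v (homogeneousComponent a F))) :=
    congrArg (fun f => f (homogeneousComponent a F)) hom2
  rw [eval_smul_of_isHomogeneous ((homogeneousComponent_isHomogeneous a F).map _), h2, hFa, C_0,
    map_zero, mul_zero] at h1
  exact Ideal.Quotient.eq_zero_iff_mem.mp h1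

theorem chainDim_le_height {R : Type*} [CommRing R] {I m : Ideal R} [m.IsPrime] (hI : I ≤ m) :
    chainDim {q : Ideal R | q.IsPrime} I m ≤ ((m.map (Ideal.Quotient.mk I)).height : ℕ∞) := by
  have hprime : ∀ q : Ideal R, q.IsPrime → I ≤ q → (q.map (Ideal.Quotient.mk I)).IsPrime :=
    fun q _ hq => Ideal.isPrime_map_quotientMk_of_isPrime hq
  have := hprime m inferInstance hI
  rw [PrimeSpectrum.height_eq_orderHeight ⟨m.map (Ideal.Quotient.mk I), this⟩,
    Order.height_eq_krullDim_Iic]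
  refine Order.krullDim_le_of_strictMono
    (fun q => ⟨⟨q.1.map (Ideal.Quotient.mk I), hprime _ q.2.1 q.2.2.1⟩,
      Ideal.map_mono q.2.2.2⟩) fun a b hab => ?_
  have hback : ∀ q : Ideal R, I ≤ q →
      (q.map (Ideal.Quotient.mk I)).comap (Ideal.Quotient.mk I) = q := fun q hq => by
    rw [Ideal.comap_map_of_surjective' _ Ideal.Quotient.mk_surjective, Ideal.mk_ker,
      sup_eq_left.mpr hq]
  refine lt_of_le_of_ne (Ideal.map_mono hab.le) fun h => hab.ne (Subtype.ext ?_)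
  have h' : a.1.map (Ideal.Quotient.mk I) = b.1.map (Ideal.Quotient.mk I) :=
    congrArg (fun x => x.1.asIdeal) h
  rw [← hback a.1 a.2.2.1, h', hback b.1 b.2.2.1]

/-- The dimension of an affine cone at a point is at most one more than the projective
dimension. -/
theorem chainDim_point_le [Infinite L] [Fintype σ] {I : Ideal (MvPolynomial σ L)} (hI : IsHomog I)
    {v : σ → L} (hv : v ≠ 0) (hIv : I ≤ vanishingIdeal L {v}) {D : ℕ}
    (hD : chainDim {q | q.IsPrime ∧ IsHomog q} I (lineIdeal v) ≤ D) :
    chainDim {q | q.IsPrime} I (vanishingIdeal L {v}) ≤ (D + 1 : ℕ) := by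
  classical
  obtain ⟨i₀, hi₀⟩ := Function.ne_iff.mp hv
  -- Since ℓ(v) = 1, the forms `X i - C (v i) * ℓ` cut out the line through `v`. Combining them into
  -- `D` forms isolates the line in the cone, and `ℓ - 1` then isolates `v`: `D + 1` elements in all
  -- for Krull's theorem modulo `I`.
  set ℓ : MvPolynomial σ L := C (v i₀)⁻¹ * X i₀ with hℓ
  have hℓ1 : ℓ.IsHomogeneous 1 := isHomogeneous_C_mul_X _ _
  have hℓv : eval v ℓ = 1 := by
    simp only [hℓ, map_mul, eval_C, eval_X]
    exact inv_mul_cancel₀ hi₀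
  have hform : ∀ i, (X i - C (v i) * ℓ).IsHomogeneous 1 := fun i =>
    (isHomogeneous_X L i).sub (hℓ1.C_mul _)
  obtain ⟨g, hg, hgH, hgM⟩ := exists_cut_to_points (fun i : σ => X i - C (v i) * ℓ)
    (S := {q | q.IsPrime ∧ IsHomog q}) (M := {lineIdeal v}) (H := IsHomog)
    (fun p hp => hp.1) (fun J hJ p hp => ⟨hp.1.1, isHomog_of_mem_minimalPrimes hJ hp⟩)
    (fun J hJ x hx => by
      refine Ideal.IsHomogeneous.sup hJ (isHomog_span ?_)
      rintro _ rfl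
      refine ⟨1, ?_⟩
      have hle : Submodule.span L (Set.range fun i : σ => X i - C (v i) * ℓ) ≤
          homogeneousSubmodule σ L 1 := by
        rw [Submodule.span_le]
        rintro _ ⟨i, rfl⟩
        exact hform i
      exact hle hx)
    (by rintro _ rfl; exact ⟨inferInstance, isHomog_lineIdeal v⟩)
    (by
      rintro p hp hall _ rfl hle
      exact le_antisymm hle (lineIdeal_le_of_mem hall))
    D I hI (by
      rintro _ rfl p hp hIp -
      exact (chainDim_anti _ hIp _).trans hD)
  set s : Set (MvPolynomial σ L) := insert (ℓ - 1) (Set.range g) with hs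
  have hsm : ∀ x ∈ s, x ∈ vanishingIdeal L ({v} : Set (σ → L)) := by
    rintro x (rfl | ⟨i, rfl⟩)
    · rw [mem_point]; simp [hℓv]
    · have hle : Submodule.span L (Set.range fun i : σ => X i - C (v i) * ℓ) ≤
          (vanishingIdeal L ({v} : Set (σ → L))).restrictScalars L := by
        rw [Submodule.span_le]
        rintro _ ⟨i, rfl⟩
        simp [hℓv]
      exact hle (hg i)
  have hmin : vanishingIdeal L {v} ∈ (Ideal.span s ⊔ RingHom.ker (Ideal.Quotient.mk I)).minimalPrimes := by
    rw [Ideal.mk_ker]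
    refine ⟨⟨inferInstance, sup_le (Ideal.span_le.mpr hsm) hIv⟩, fun p hp hpm => ?_⟩
    have hpp := hp.1
    obtain ⟨hsp, hIp⟩ := sup_le_iff.mp hp.2
    have hgp : I ⊔ Ideal.span (Set.range g) ≤ p :=
      sup_le hIp ((Ideal.span_mono (Set.subset_insert _ _)).trans hsp)
    obtain ⟨p₀, hp₀, hp₀p⟩ := Ideal.exists_minimalPrimes_le hgp
    have hp₀H := isHomog_of_mem_minimalPrimes hgH hp₀
    have h1 : p₀ = lineIdeal v := hgM _ rfl p₀ ⟨hp₀.1.1, hp₀H⟩ hp₀.1.2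
      ((le_lineIdeal_iff hp₀H).mpr (hp₀p.trans hpm))
    refine point_le fun i => ?_
    have h2 : X i - C (v i) * ℓ ∈ p := by
      refine hp₀p ?_
      rw [h1, mem_lineIdeal (hform i)]
      simp [hℓv]
    have h3 : ℓ - 1 ∈ p := hsp (Ideal.subset_span (Set.mem_insert _ _))
    have := add_mem h2 (p.mul_mem_left (C (v i)) h3)
    rwa [show X i - C (v i) * ℓ + C (v i) * (ℓ - 1) = X i - C (v i) by ring] at this
  refine (chainDim_le_height hIv).trans ?_
  have hfin : s.Finite := (Set.finite_range g).insert _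
  have hmin' : (vanishingIdeal L {v}).map (Ideal.Quotient.mk I) ∈
      (Ideal.span (Ideal.Quotient.mk I '' s)).minimalPrimes := by
    rw [← Ideal.map_span, Ideal.minimalPrimes_map_of_surjective Ideal.Quotient.mk_surjective]
    exact ⟨_, hmin, rfl⟩
  have hht := Ideal.height_le_card_of_mem_minimalPrimes_span (hfin.image _) hmin'
  have hcard : (Ideal.Quotient.mk I '' s).ncard ≤ D + 1 := by
    refine (Set.ncard_image_le hfin).trans ((Set.ncard_insert_le _ _).trans ?_)
    have : (Set.range g).ncard ≤ D := by
      rw [← Set.image_univ]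
      exact (Set.ncard_image_le Set.finite_univ).trans (by simp [Set.ncard_univ])
    omega
  exact WithBot.coe_le_coe.mpr (hht.trans (by exact_mod_cast hcard))

end Homogeneous

/-! ### Comparing the Zariski dimension with chains of homogeneous primes -/

section Topology

attribute [local instance] MvPolynomial.gradedAlgebra zariskiTopology

variable {L σ : Type*} [Field L]

theorem eval_rep_mk_ne_zero_iff {F : MvPolynomial σ L} {a : ℕ} (hF : F.IsHomogeneous a)
    {w : σ → L} (hw : w ≠ 0) :
    eval (Projectivization.mk L w hw).rep F ≠ 0 ↔ eval w F ≠ 0 := by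
  obtain ⟨c, hc⟩ := Projectivization.exists_smul_eq_mk_rep L w hw
  rw [← hc, show (c • w : σ → L) = fun i => (c : L) * w i from rfl,
    eval_smul_of_isHomogeneous hF]
  simp

theorem lineIdeal_rep_mk {w : σ → L} (hw : w ≠ 0) :
    lineIdeal (Projectivization.mk L w hw).rep = lineIdeal w := by
  have key : ∀ F : MvPolynomial σ L, ∀ u : σ → L, F ∈ lineIdeal u ↔
      ∀ a, eval u (homogeneousComponent a F) = 0 := fun F u => by
    constructor
    · intro h a
      rw [← mem_lineIdeal (homogeneousComponent_isHomogeneous a F)]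
      exact homogeneousComponent_mem_of_mem (isHomog_lineIdeal u) h a
    · intro h
      rw [← sum_homogeneousComponent F]
      exact Ideal.sum_mem _ fun a _ =>
        (mem_lineIdeal (homogeneousComponent_isHomogeneous a F)).mpr (h a)
  ext F
  rw [key, key]
  exact forall_congr' fun a => not_iff_not.mp
    (eval_rep_mk_ne_zero_iff (homogeneousComponent_isHomogeneous a F) hw)

theorem isOpen_nonvanishing {F : MvPolynomial σ L} {a : ℕ} (hF : F.IsHomogeneous a) :
    IsOpen {P : ℙ L (σ → L) | eval P.rep F ≠ 0} :=
  TopologicalSpace.isOpen_generateFrom_of_mem ⟨a, F, hF, rfl⟩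

theorem exists_nonvanishing_subset {U : Set (ℙ L (σ → L))} (hU : IsOpen U) {P : ℙ L (σ → L)}
    (hP : P ∈ U) : ∃ (a : ℕ) (F : MvPolynomial σ L), F.IsHomogeneous a ∧ eval P.rep F ≠ 0 ∧
      ∀ Q : ℙ L (σ → L), eval Q.rep F ≠ 0 → Q ∈ U := by
  induction hU with
  | basic s hs =>
    obtain ⟨a, F, hF, rfl⟩ := hs
    exact ⟨a, F, hF, hP, fun _ h => h⟩
  | univ => exact ⟨0, 1, isHomogeneous_one σ L, by simp, fun _ _ => trivial⟩
  | inter s t _ _ ihs iht =>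
    obtain ⟨a, F, hF, hFP, hFs⟩ := ihs hP.1
    obtain ⟨b, G, hG, hGP, hGt⟩ := iht hP.2
    refine ⟨a + b, F * G, hF.mul hG, by rw [map_mul]; exact mul_ne_zero hFP hGP, fun Q hQ => ?_⟩
    rw [map_mul] at hQ
    exact ⟨hFs Q (left_ne_zero_of_mul hQ), hGt Q (right_ne_zero_of_mul hQ)⟩
  | sUnion S _ ih =>
    obtain ⟨s, hs, hPs⟩ := hP
    obtain ⟨a, F, hF, hFP, hFs⟩ := ih s hs hPs
    exact ⟨a, F, hF, hFP, fun Q hQ => ⟨s, hs, hFs Q hQ⟩⟩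

/-- The same for open subsets of a subspace. -/
theorem exists_nonvanishing_subset_subtype {M : Set (ℙ L (σ → L))} {U : Set M} (hU : IsOpen U)
    {P : M} (hP : P ∈ U) : ∃ (a : ℕ) (F : MvPolynomial σ L), F.IsHomogeneous a ∧
      eval P.1.rep F ≠ 0 ∧ ∀ Q : M, eval Q.1.rep F ≠ 0 → Q ∈ U := by
  obtain ⟨V, hV, rfl⟩ := isOpen_induced_iff.mp hU
  obtain ⟨a, F, hF, hFP, hFV⟩ := exists_nonvanishing_subset hV hP
  exact ⟨a, F, hF, hFP, fun Q hQ => hFV Q.1 hQ⟩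

theorem exists_homogeneous_mem_notMem {q q' : Ideal (MvPolynomial σ L)} (hq' : IsHomog q')
    (h : ¬ q' ≤ q) : ∃ (a : ℕ) (F : MvPolynomial σ L), F.IsHomogeneous a ∧ F ∈ q' ∧ F ∉ q := by
  by_contra! hall
  refine h fun F hF => ?_
  rw [← sum_homogeneousComponent F]
  exact Ideal.sum_mem _ fun a _ => hall a _ (homogeneousComponent_isHomogeneous a F)
    (homogeneousComponent_mem_of_mem hq' hF a)

/-- The Zariski dimension of a subset of projective space is finite. -/
theorem zariskiDim_le_card [Fintype σ] (M : Set (ℙ L (σ → L))) :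
    zariskiDim M ≤ (Fintype.card σ : ℕ) := by
  have hdim : ringKrullDim (MvPolynomial σ L) = (Fintype.card σ : ℕ) := by simp
  -- The ideal of the cone over `Z`: irreducibility makes it prime, and closedness of `Z` in `M`
  -- makes the assignment strictly order-reversing.
  let I : TopologicalSpace.IrreducibleCloseds M → Ideal (MvPolynomial σ L) := fun Z =>
    ⨅ Q : (Z : Set M), lineIdeal Q.1.1.rep
  have hmem : ∀ Z F a, F.IsHomogeneous a →
      (F ∈ I Z ↔ ∀ Q ∈ (Z : Set M), eval Q.1.rep F = 0) := fun Z F a hF => by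
    simp only [I, Ideal.mem_iInf, mem_lineIdeal hF, Subtype.forall]
  have hhom : ∀ Z, IsHomog (I Z) := fun Z =>
    Ideal.IsHomogeneous.iInf fun Q => isHomog_lineIdeal _
  have hprime : ∀ Z, (I Z).IsPrime := fun Z => by
    obtain ⟨Q₀, hQ₀⟩ := Z.isIrreducible.nonempty
    refine (hhom Z).isPrime_of_homogeneous_mem_or_mem (fun htop => ?_) ?_
    · have h1 : (1 : MvPolynomial σ L) ∈ I Z := htop ▸ trivial
      rw [hmem Z 1 0 (isHomogeneous_one σ L)] at h1
      simpa using h1 Q₀ hQ₀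
    · rintro x y ⟨a, hx⟩ ⟨b, hy⟩ hxy
      have hx : x.IsHomogeneous a := hx
      have hy : y.IsHomogeneous b := hy
      by_contra! hcon
      rw [hmem Z x a hx, hmem Z y b hy] at hcon
      obtain ⟨⟨Q₁, hQ₁, h₁⟩, ⟨Q₂, hQ₂, h₂⟩⟩ : (∃ Q ∈ (Z : Set M), eval Q.1.rep x ≠ 0) ∧
          ∃ Q ∈ (Z : Set M), eval Q.1.rep y ≠ 0 := by
        simpa using hcon
      obtain ⟨Q, hQ, hQx, hQy⟩ := Z.isIrreducible.2 _ _
        ((isOpen_nonvanishing hx).preimage continuous_subtype_val)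
        ((isOpen_nonvanishing hy).preimage continuous_subtype_val) ⟨Q₁, hQ₁, h₁⟩ ⟨Q₂, hQ₂, h₂⟩
      have := (hmem Z (x * y) (a + b) (hx.mul hy)).mp hxy Q hQ
      rw [map_mul] at this
      exact (mul_ne_zero hQx hQy) this
  unfold zariskiDim topologicalKrullDim
  rw [← Order.krullDim_orderDual, ← hdim]
  refine Order.krullDim_le_of_strictMono
    (fun Z => (⟨I (OrderDual.ofDual Z), hprime _⟩ : PrimeSpectrum (MvPolynomial σ L)))
    fun Z' Z h => ?_
  obtain ⟨Z, rfl⟩ := OrderDual.toDual.surjective Z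
  obtain ⟨Z', rfl⟩ := OrderDual.toDual.surjective Z'
  have hlt : Z < Z' := h
  have hsub : (Z : Set M) ⊆ Z' := hlt.le
  have hle : I Z' ≤ I Z :=
    le_iInf fun Q => iInf_le (fun Q : (Z' : Set M) => lineIdeal Q.1.1.rep)
      ⟨Q.1, hsub Q.2⟩
  refine lt_of_le_of_ne hle fun heq => ?_
  have heq : I Z' = I Z :=
    congrArg PrimeSpectrum.asIdeal heq
  obtain ⟨Q, hQ', hQ⟩ := Set.exists_of_ssubset (SetLike.coe_ssubset_coe.mpr hlt)
  obtain ⟨a, F, hF, hFQ, hFZ⟩ := exists_nonvanishing_subset_subtype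
    Z.isClosed.isOpen_compl hQ
  have hFI : F ∈ I Z := by
    rw [hmem _ F a hF]
    intro P hP
    by_contra hne
    exact hFZ P hne hP
  rw [← heq, hmem _ F a hF] at hFI
  exact hFQ (hFI Q hQ')

variable [IsAlgClosed L]

/-- A form outside a homogeneous prime ideal `q` with a zero in projective space does not vanish
at some zero of `q`. -/
theorem exists_zero_of_notMem [Finite σ] {q : Ideal (MvPolynomial σ L)} (hq : q.IsPrime)
    (hqh : IsHomog q) {P : ℙ L (σ → L)} (hP : q ≤ lineIdeal P.rep) {G : MvPolynomial σ L} {a : ℕ}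
    (hG : G.IsHomogeneous a) (hGq : G ∉ q) :
    ∃ Q : ℙ L (σ → L), q ≤ lineIdeal Q.rep ∧ eval Q.rep G ≠ 0 := by
  have hw : ∃ w : σ → L, q ≤ vanishingIdeal L {w} ∧ eval w G ≠ 0 := by
    by_contra! hall
    apply hGq
    rw [← hq.radical, ← vanishingIdeal_zeroLocus_eq_radical (K := L)]
    intro w hw
    rw [aeval_eq_eval]
    refine hall w fun F hF => mem_point.mpr ?_
    have := hw F hF
    rwa [aeval_eq_eval] at this
  obtain ⟨w, hqw, hGw⟩ := hw
  by_cases hw0 : w = 0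
  -- The Nullstellensatz may return the origin, which is no projective point; then `G` is a nonzero
  -- constant and the given zero `P` serves.
  · have ha : a = 0 := by
      by_contra ha
      apply hGw
      rw [hw0, show (0 : σ → L) = fun i => 0 * (0 : σ → L) i by funext i; simp,
        eval_smul_of_isHomogeneous hG, zero_pow ha, zero_mul]
    subst ha
    refine ⟨P, hP, ?_⟩
    rw [totalDegree_eq_zero_iff_eq_C.mp (Nat.le_zero.mp hG.totalDegree_le)] at hGw ⊢
    simpa using hGw
  · refine ⟨Projectivization.mk L w hw0, ?_, (eval_rep_mk_ne_zero_iff hG hw0).mpr hGw⟩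
    rw [lineIdeal_rep_mk hw0]
    exact (le_lineIdeal_iff hqh).mpr hqw

/-- Chains of homogeneous primes at a point of a locally closed subset of projective space are at
most as long as its dimension. -/
theorem chainDim_lineIdeal_le_zariskiDim [Finite σ] {M : Set (ℙ L (σ → L))}
    {I : Ideal (MvPolynomial σ L)} {P : ℙ L (σ → L)}
    {b : ℕ} {h : MvPolynomial σ L} (hh : h.IsHomogeneous b) (hP : eval P.rep h ≠ 0)
    (hM : ∀ Q : ℙ L (σ → L), eval Q.rep h ≠ 0 → I ≤ lineIdeal Q.rep → Q ∈ M) :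
    chainDim {q | q.IsPrime ∧ IsHomog q} I (lineIdeal P.rep) ≤ zariskiDim M := by
  let Z : Ideal (MvPolynomial σ L) → Set M := fun q => {Q | q ≤ lineIdeal Q.1.rep}
  have hclosed : ∀ q, IsHomog q → IsClosed (Z q) := fun q hq => by
    rw [← isOpen_compl_iff, isOpen_iff_forall_mem_open]
    intro Q hQ
    obtain ⟨a, F, hF, hFq, hFQ⟩ := exists_homogeneous_mem_notMem hq (show ¬ q ≤ lineIdeal Q.1.rep from hQ)
    refine ⟨_, ?_, (isOpen_nonvanishing hF).preimage continuous_subtype_val, ?_⟩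
    · intro Q' hQ' hQ''
      exact hQ' ((mem_lineIdeal hF).mp (hQ'' hFq))
    · exact fun h0 => hFQ ((mem_lineIdeal hF).mpr h0)
  -- The zeros of `q` inside `M` are dense among all zeros of `q`: since `h` is not in `q`, neither
  -- is `h * G`, and a zero of `q` where `h * G` is nonzero lies in `M`. Irreducibility of `Z q` and
  -- strictness of the order both rest on this.
  have hkey : ∀ q : Ideal (MvPolynomial σ L), q.IsPrime → IsHomog q → I ≤ q →
      q ≤ lineIdeal P.rep → ∀ (a : ℕ) (G : MvPolynomial σ L), G.IsHomogeneous a → G ∉ q →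
      ∃ Q ∈ Z q, eval Q.1.rep G ≠ 0 := fun q hq hqh hIq hqP a G hG hGq => by
    have hhq : h ∉ q := fun h0 => hP ((mem_lineIdeal hh).mp (hqP h0))
    obtain ⟨Q, hQ, hQG⟩ := exists_zero_of_notMem hq hqh hqP (hh.mul hG)
      fun h0 => (hq.mem_or_mem h0).elim hhq hGq
    rw [map_mul] at hQG
    exact ⟨⟨Q, hM Q (left_ne_zero_of_mul hQG) (hIq.trans hQ)⟩, hQ, right_ne_zero_of_mul hQG⟩
  have hirr : ∀ q : Ideal (MvPolynomial σ L), q.IsPrime → IsHomog q → I ≤ q →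
      q ≤ lineIdeal P.rep → IsIrreducible (Z q) := fun q hq hqh hIq hqP => by
    constructor
    · obtain ⟨Q, hQ, -⟩ := hkey q hq hqh hIq hqP 0 1 (isHomogeneous_one σ L)
        ((Ideal.ne_top_iff_one q).mp hq.ne_top)
      exact ⟨Q, hQ⟩
    · rintro U V hU hV ⟨Q₁, hQ₁, hU₁⟩ ⟨Q₂, hQ₂, hV₂⟩
      obtain ⟨a₁, F₁, hF₁, hFQ₁, hFU⟩ := exists_nonvanishing_subset_subtype hU hU₁
      obtain ⟨a₂, F₂, hF₂, hFQ₂, hFV⟩ := exists_nonvanishing_subset_subtype hV hV₂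
      obtain ⟨Q, hQ, hne⟩ := hkey q hq hqh hIq hqP _ _ (hF₁.mul hF₂) fun h0 =>
        (hq.mem_or_mem h0).elim (fun h1 => hFQ₁ ((mem_lineIdeal hF₁).mp (hQ₁ h1)))
          fun h2 => hFQ₂ ((mem_lineIdeal hF₂).mp (hQ₂ h2))
      rw [map_mul] at hne
      exact ⟨Q, hQ, hFU Q (left_ne_zero_of_mul hne), hFV Q (right_ne_zero_of_mul hne)⟩
  unfold zariskiDim topologicalKrullDim chainDim
  rw [← Order.krullDim_orderDual (α := TopologicalSpace.IrreducibleCloseds M)]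
  refine Order.krullDim_le_of_strictMono (fun q => OrderDual.toDual
    (⟨Z q.1, hirr q.1 q.2.1.1 q.2.1.2 q.2.2.1 q.2.2.2, hclosed q.1 q.2.1.2⟩ :
      TopologicalSpace.IrreducibleCloseds M)) fun q q' hlt => ?_
  rw [OrderDual.toDual_lt_toDual]
  have hsub : Z q'.1 ⊆ Z q.1 := fun Q hQ => (show q.1 ≤ q'.1 from hlt.le).trans hQ
  refine lt_of_le_of_ne hsub fun heq => ?_
  have heq : Z q'.1 = Z q.1 := congrArg TopologicalSpace.IrreducibleCloseds.carrier heq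
  obtain ⟨a, G, hG, hGq', hGq⟩ := exists_homogeneous_mem_notMem q'.2.1.2
    (show ¬ q'.1 ≤ q.1 from not_le_of_gt hlt)
  obtain ⟨Q, hQ, hQG⟩ := hkey q.1 q.2.1.1 q.2.1.2 q.2.2.1 q.2.2.2 a G hG hGq
  rw [← heq] at hQ
  exact hQG ((mem_lineIdeal hG).mp (hQ hGq'))

end Topology

/-! ### Counting on the cone over a locally closed set -/

section Core

variable {L σ : Type*} [Field L] [IsAlgClosed L] [Fintype σ]

/-- The number of points with coordinates in a finite set `T` on the affine cone over a locally
closed subset `M` of projective space. -/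
theorem exists_zariskiDim_eq_and_card_le {κ : Type*} [Fintype κ] {f : κ → MvPolynomial σ L}
    {d δ : κ → ℕ} (hd : ∀ k, (f k).IsHomogeneous (d k)) (hδ : ∀ k, 1 ≤ δ k)
    (hdδ : ∀ k, d k ≤ δ k) {M : Set (ℙ L (σ → L))} (hne : M.Nonempty)
    (hMf : ∀ Q ∈ M, ∀ k, eval Q.rep (f k) = 0)
    (hM : ∀ P ∈ M, ∃ (b : ℕ) (h : MvPolynomial σ L), h.IsHomogeneous b ∧ eval P.rep h ≠ 0 ∧
      ∀ Q : ℙ L (σ → L), eval Q.rep h ≠ 0 → (∀ k, eval Q.rep (f k) = 0) → Q ∈ M) :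
    ∃ D : ℕ, zariskiDim M = (D : WithBot ℕ∞) ∧
      ∀ (T : Finset L), T.Nonempty → ∀ {ι : Type*} [Fintype ι] (v : ι → σ → L),
        Function.Injective v → (∀ j i, v j i ∈ T) →
        (∀ j, ∃ h : v j ≠ 0, Projectivization.mk L (v j) h ∈ M) →
        Fintype.card ι ≤ (∏ k, δ k) * T.card ^ (D + 1) := by
  have hIhom : IsHomog (Ideal.span (Set.range f)) := isHomog_span (by
    rintro _ ⟨k, rfl⟩; exact ⟨d k, hd k⟩)
  have hIiff : ∀ u : σ → L, Ideal.span (Set.range f) ≤ lineIdeal u ↔ ∀ k, eval u (f k) = 0 :=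
    fun u => by
      rw [Ideal.span_le, Set.range_subset_iff]
      exact forall_congr' fun k => mem_lineIdeal (hd k)
  obtain ⟨D, hD⟩ : ∃ D : ℕ, zariskiDim M = (D : WithBot ℕ∞) := by
    have h1 := zariskiDim_le_card M
    have h2 : (0 : WithBot ℕ∞) ≤ zariskiDim M := by
      let _ := zariskiTopology L σ
      obtain ⟨Q, hQ⟩ := hne
      have : Nonempty (TopologicalSpace.IrreducibleCloseds M) :=
        ⟨⟨closure {⟨Q, hQ⟩}, isIrreducible_singleton.closure, isClosed_closure⟩⟩
      exact Order.krullDim_nonneg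
    generalize zariskiDim M = x at h1 h2
    induction x with
    | bot => simp at h2
    | coe x =>
      induction x with
      | top => exact absurd (WithBot.coe_le_coe.mp h1) (ENat.natCast_lt_top _).not_ge
      | coe x => exact ⟨x, rfl⟩
  refine ⟨D, hD, fun T hT ι _ v hinj hvT hvM => ?_⟩
  have hvf : ∀ j k, eval (v j) (f k) = 0 := fun j k => by
    obtain ⟨hv0, hvj⟩ := hvM j
    exact not_not.mp (mt (eval_rep_mk_ne_zero_iff (hd k) hv0).mpr (not_not.mpr (hMf _ hvj k)))
  refine card_points_le hδ (fun k => (hd k).totalDegree_le.trans (hdδ k)) hT hinj hvT hvf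
    fun j => ?_
  obtain ⟨hv0, hvj⟩ := hvM j
  obtain ⟨b, h, hh, hhP, hhM⟩ := hM _ hvj
  refine chainDim_point_le hIhom hv0 ((le_lineIdeal_iff hIhom).mp ((hIiff _).mpr (hvf j))) ?_
  rw [← hD, ← lineIdeal_rep_mk hv0]
  exact chainDim_lineIdeal_le_zariskiDim hh hhP
    fun Q hQ hQf => hhM Q hQ ((hIiff _).mp hQf)

end Core

end RatCurves

namespace RatCurves

/-! ### Equations on the coefficients of a tuple of binary forms -/

section Coefficients

variable {n e : ℕ}

/-- The tuple of polynomials of degree at most `e` with coefficient vector `v`. -/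
noncomputable def polyTuple {A : Type*} [CommRing A] (v : Fin n × Fin (e + 1) → A) (j : Fin n) :
    Polynomial A :=
  ∑ k : Fin (e + 1), Polynomial.C (v (j, k)) * Polynomial.X ^ (k : ℕ)

section

variable {A : Type*} [CommRing A] (v : Fin n × Fin (e + 1) → A)

theorem polyTuple_map {B : Type*} [CommRing B] (φ : A →+* B) (j : Fin n) :
    (polyTuple v j).map φ = polyTuple (fun x => φ (v x)) j := by
  simp [polyTuple, Polynomial.map_sum]

theorem polyTuple_coeff (j : Fin n) (l : ℕ) :
    (polyTuple v j).coeff l = if h : l < e + 1 then v (j, ⟨l, h⟩) else 0 := by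
  simp only [polyTuple, Polynomial.finsetSum_coeff, Polynomial.coeff_C_mul_X_pow]
  split_ifs with h
  · rw [Finset.sum_eq_single ⟨l, h⟩]
    · simp
    · rintro k - hk
      rw [if_neg fun h' => hk (Fin.ext h'.symm)]
    · simp
  · refine Finset.sum_eq_zero fun k _ => if_neg fun h' => h (by have := k.2; omega)

theorem polyTuple_natDegree_le (j : Fin n) : (polyTuple v j).natDegree ≤ e :=
  Polynomial.natDegree_sum_le_of_forall_le _ _ fun k _ =>
    (Polynomial.natDegree_C_mul_X_pow_le _ _).trans (Nat.lt_succ_iff.mp k.2)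

end

section Field

variable {L : Type*} [Field L] (v : Fin n × Fin (e + 1) → L)

theorem formTuple_smul (c : L) (p : Fin 2 → L) : formTuple (c • v) p = c • formTuple v p := by
  funext j
  simp [formTuple, Finset.mul_sum, mul_assoc]

theorem formTuple_of_ne_zero {p : Fin 2 → L} (hp : p 1 ≠ 0) (j : Fin n) :
    formTuple v p j = p 1 ^ e * (polyTuple v j).eval (p 0 / p 1) := by
  simp only [formTuple, polyTuple, Polynomial.eval_finsetSum, Polynomial.eval_mul,
    Polynomial.eval_C, Polynomial.eval_pow, Polynomial.eval_X, Finset.mul_sum]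
  refine Finset.sum_congr rfl fun k _ => ?_
  have : p 1 ^ e = p 1 ^ (k : ℕ) * p 1 ^ (e - (k : ℕ)) := by
    rw [← pow_add, Nat.add_sub_cancel' (Nat.lt_succ_iff.mp k.2)]
  rw [this, div_pow]
  field_simp

theorem formTuple_of_eq_zero {p : Fin 2 → L} (hp : p 1 = 0) (j : Fin n) :
    formTuple v p j = v (j, Fin.last e) * p 0 ^ e := by
  simp only [formTuple]
  rw [Finset.sum_eq_single (Fin.last e)]
  · simp
  · intro k _ hk
    have : (k : ℕ) < e := Fin.val_lt_last hk
    rw [hp, zero_pow (by omega), mul_zero]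
  · simp

theorem formTuple_affine (s : L) (j : Fin n) :
    formTuple v ![s, 1] j = (polyTuple v j).eval s := by
  rw [formTuple_of_ne_zero v (by simp)]; simp

end Field

section Equations

variable {k : Type*} [Field k]

theorem aeval_eq_eval_map {L : Type*} [CommRing L] [Algebra k L] {τ : Type*} (w : τ → L)
    (F : MvPolynomial τ k) :
    MvPolynomial.aeval w F = MvPolynomial.eval w (MvPolynomial.map (algebraMap k L) F) := by
  rw [MvPolynomial.aeval_def, MvPolynomial.eval_map]

theorem aeval_smul_of_isHomogeneous {L : Type*} [CommRing L] [Algebra k L] {τ : Type*}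
    {F : MvPolynomial τ k} {d : ℕ} (hF : F.IsHomogeneous d) (c : L) (w : τ → L) :
    MvPolynomial.aeval (c • w) F = c ^ d * MvPolynomial.aeval w F := by
  rw [aeval_eq_eval_map, aeval_eq_eval_map, ← eval_smul_of_isHomogeneous (hF.map _)]
  rfl

theorem eval_aeval {L : Type*} [CommRing L] [Algebra k L] {τ : Type*}
    (y : τ → Polynomial L) (F : MvPolynomial τ k) (s : L) :
    (MvPolynomial.aeval y F).eval s = MvPolynomial.aeval (fun j => (y j).eval s) F := by
  have : (Polynomial.evalRingHom s).comp (MvPolynomial.aeval y : MvPolynomial τ k →ₐ[k] _).toRingHom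
      = (MvPolynomial.aeval (fun j => (y j).eval s) : MvPolynomial τ k →ₐ[k] L).toRingHom := by
    ext x
    · simp [Polynomial.algebraMap_apply]
    · simp
  exact congrArg (fun f => f F) this

/-- The equations on the coefficient vector of a tuple of polynomials expressing that the tuple
is a zero of `F`. -/
noncomputable def coeffEquation (L : Type*) [Field L] [Algebra k L] (e : ℕ)
    (F : MvPolynomial (Fin n) k) (l : ℕ) : MvPolynomial (Fin n × Fin (e + 1)) L :=
  (MvPolynomial.aeval (polyTuple (A := MvPolynomial (Fin n × Fin (e + 1)) L) MvPolynomial.X)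
    F).coeff l

variable {L : Type*} [Field L] [Algebra k L]

theorem eval_coeffEquation (F : MvPolynomial (Fin n) k) (l : ℕ) (v : Fin n × Fin (e + 1) → L) :
    MvPolynomial.eval v (coeffEquation L e F l) =
      (MvPolynomial.aeval (polyTuple v) F).coeff l := by
  have : (Polynomial.mapRingHom (MvPolynomial.eval v)).comp (MvPolynomial.aeval
      (polyTuple (A := MvPolynomial (Fin n × Fin (e + 1)) L) MvPolynomial.X) :
        MvPolynomial (Fin n) k →ₐ[k] _).toRingHom =
      (MvPolynomial.aeval (polyTuple v) : MvPolynomial (Fin n) k →ₐ[k] _).toRingHom := by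
    ext x
    · simp [Polynomial.algebraMap_apply, MvPolynomial.algebraMap_apply]
    · simp [polyTuple_map]
  rw [coeffEquation, ← Polynomial.coeff_map]
  exact congrArg (fun f => (f F).coeff l) this

theorem isHomogeneous_coeff_mul {τ R : Type*} [CommRing R] {P Q : Polynomial (MvPolynomial τ R)}
    {a b : ℕ} (hP : ∀ l, (P.coeff l).IsHomogeneous a) (hQ : ∀ l, (Q.coeff l).IsHomogeneous b)
    (l : ℕ) : ((P * Q).coeff l).IsHomogeneous (a + b) := by
  rw [Polynomial.coeff_mul]
  exact MvPolynomial.IsHomogeneous.sum _ _ _ fun x _ => (hP x.1).mul (hQ x.2)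

theorem isHomogeneous_coeff_one {τ R : Type*} [CommRing R] (l : ℕ) :
    ((1 : Polynomial (MvPolynomial τ R)).coeff l).IsHomogeneous 0 := by
  rw [Polynomial.coeff_one]
  split_ifs
  · exact MvPolynomial.isHomogeneous_one _ _
  · exact MvPolynomial.isHomogeneous_zero _ _ _

theorem isHomogeneous_coeff_pow {τ R : Type*} [CommRing R] {P : Polynomial (MvPolynomial τ R)}
    {a : ℕ} (hP : ∀ l, (P.coeff l).IsHomogeneous a) (m l : ℕ) :
    ((P ^ m).coeff l).IsHomogeneous (m * a) := by
  induction m generalizing l with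
  | zero => simpa using isHomogeneous_coeff_one l
  | succ m ih =>
    rw [pow_succ, add_mul, one_mul]
    exact isHomogeneous_coeff_mul ih hP l

theorem isHomogeneous_coeff_prod {τ R ι : Type*} [CommRing R]
    {P : ι → Polynomial (MvPolynomial τ R)} {a : ι → ℕ} (s : Finset ι)
    (hP : ∀ i l, ((P i).coeff l).IsHomogeneous (a i)) (l : ℕ) :
    ((∏ i ∈ s, P i).coeff l).IsHomogeneous (∑ i ∈ s, a i) := by
  classical
  induction s using Finset.induction_on generalizing l with
  | empty => simpa using isHomogeneous_coeff_one l
  | insert i s hi ih =>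
    rw [Finset.prod_insert hi, Finset.sum_insert hi]
    exact isHomogeneous_coeff_mul (hP i) ih l

theorem isHomogeneous_coeffEquation {F : MvPolynomial (Fin n) k} {d : ℕ} (hF : F.IsHomogeneous d)
    (l : ℕ) : (coeffEquation L e F l).IsHomogeneous d := by
  rw [coeffEquation, MvPolynomial.aeval_def, MvPolynomial.eval₂_eq', Polynomial.finsetSum_coeff]
  refine MvPolynomial.IsHomogeneous.sum _ _ _ fun s hs => ?_
  have hsd : ∑ i, s i = d := by
    rw [hF.degree_eq_sum_deg_support hs]
    exact (Finset.sum_subset (Finset.subset_univ _) fun i _ hi => by simpa using hi).symm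
  rw [Polynomial.algebraMap_apply, Polynomial.coeff_C_mul, MvPolynomial.algebraMap_apply]
  refine MvPolynomial.IsHomogeneous.C_mul ?_ _
  rw [← hsd]
  refine isHomogeneous_coeff_prod _ (fun i l => ?_) l
  have := isHomogeneous_coeff_pow (P := polyTuple (A := MvPolynomial (Fin n × Fin (e + 1)) L)
    MvPolynomial.X i) (a := 1) (fun l => by
      rw [polyTuple_coeff]
      split_ifs
      · exact MvPolynomial.isHomogeneous_X _ _
      · exact MvPolynomial.isHomogeneous_zero _ _ _) (s i) l
  rwa [mul_one] at this

theorem natDegree_aeval_polyTuple_le {F : MvPolynomial (Fin n) k} {d : ℕ} (hF : F.IsHomogeneous d)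
    (v : Fin n × Fin (e + 1) → L) :
    (MvPolynomial.aeval (polyTuple v) F).natDegree ≤ d * e := by
  rw [MvPolynomial.aeval_def, MvPolynomial.eval₂_eq']
  refine Polynomial.natDegree_sum_le_of_forall_le _ _ fun s hs => ?_
  have hsd : ∑ i, s i = d := by
    rw [hF.degree_eq_sum_deg_support hs]
    exact (Finset.sum_subset (Finset.subset_univ _) fun i _ hi => by simpa using hi).symm
  rw [Polynomial.algebraMap_apply]
  refine (Polynomial.natDegree_C_mul_le _ _).trans ((Polynomial.natDegree_prod_le _ _).trans ?_)
  rw [← hsd, Finset.sum_mul]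
  exact Finset.sum_le_sum fun i _ => Polynomial.natDegree_pow_le_of_le _ (polyTuple_natDegree_le v i)

theorem forall_coeffEquation_iff {F : MvPolynomial (Fin n) k} {d : ℕ} (hF : F.IsHomogeneous d)
    (v : Fin n × Fin (e + 1) → L) :
    (∀ l : Fin (d * e + 1), MvPolynomial.eval v (coeffEquation L e F l) = 0) ↔
      MvPolynomial.aeval (polyTuple v) F = 0 := by
  constructor
  · intro h
    ext l
    rw [Polynomial.coeff_zero]
    by_cases hl : l < d * e + 1
    · rw [← eval_coeffEquation]; exact h ⟨l, hl⟩
    · exact Polynomial.coeff_eq_zero_of_natDegree_lt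
        ((natDegree_aeval_polyTuple_le hF v).trans_lt (by omega))
  · intro h l
    rw [eval_coeffEquation, h, Polynomial.coeff_zero]

theorem aeval_polyTuple_eq_zero_iff [Infinite L] {F : MvPolynomial (Fin n) k} {d : ℕ}
    (hF : F.IsHomogeneous d) (v : Fin n × Fin (e + 1) → L) :
    MvPolynomial.aeval (polyTuple v) F = 0 ↔
      ∀ p : Fin 2 → L, p ≠ 0 → MvPolynomial.aeval (formTuple v p) F = 0 := by
  constructor
  · intro h
    have hne : ∀ p : Fin 2 → L, p 1 ≠ 0 → MvPolynomial.aeval (formTuple v p) F = 0 := by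
      intro p hp
      have : formTuple v p = p 1 ^ e • fun j => (polyTuple v j).eval (p 0 / p 1) := by
        funext j; rw [formTuple_of_ne_zero v hp]; rfl
      rw [this, aeval_smul_of_isHomogeneous hF, ← eval_aeval, h]
      simp
    intro p _
    by_cases hp : p 1 = 0
    swap
    · exact hne p hp
    -- The point at infinity is reached by letting the second coordinate `u` vary: the resulting
    -- polynomial in `u` vanishes for all `u ≠ 0`, hence also at 0.
    let z : Fin n → Polynomial L := fun j => ∑ l : Fin (e + 1),
      Polynomial.C (v (j, l) * p 0 ^ (l : ℕ)) * Polynomial.X ^ (e - (l : ℕ))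
    have hz : ∀ u, MvPolynomial.aeval (formTuple v ![p 0, u]) F =
        (MvPolynomial.aeval z F).eval u := fun u => by
      rw [eval_aeval]
      congr 2
      funext j
      simp [z, formTuple, Polynomial.eval_finsetSum]
    have hz0 : MvPolynomial.aeval z F = 0 := by
      refine Polynomial.eq_zero_of_infinite_isRoot _ ((Set.finite_singleton (0 : L)).infinite_compl.mono
        fun u hu => ?_)
      rw [Set.mem_ofPred_eq, Polynomial.IsRoot, ← hz]
      exact hne _ (by simpa using hu)
    have hp' : p = ![p 0, 0] := by
      funext i; fin_cases i
      · rfl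
      · exact hp
    rw [hp', hz, hz0, Polynomial.eval_zero]
  · intro h
    refine Polynomial.funext fun s => ?_
    rw [Polynomial.eval_zero, eval_aeval, ← h ![s, 1] (fun h0 => by simpa using congrFun h0 1)]
    congr 2
    funext j
    rw [formTuple_affine]

end Equations

/-! ### Openness of the absence of common zeros -/

section Resultant

theorem isHomogeneous_det {τ R ι : Type*} [CommRing R] [Fintype ι] [DecidableEq ι]
    {N : Matrix ι ι (MvPolynomial τ R)} (hN : ∀ i j, (N i j).IsHomogeneous 1) :
    N.det.IsHomogeneous (Fintype.card ι) := by
  rw [Matrix.det_apply]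
  refine MvPolynomial.IsHomogeneous.sum _ _ _ fun s _ => ?_
  have h1 : (∏ i, N (s i) i).IsHomogeneous (Fintype.card ι) := by
    have := MvPolynomial.IsHomogeneous.prod Finset.univ (fun i => N (s i) i) (fun _ => 1)
      fun i _ => hN (s i) i
    simpa using this
  rcases Int.units_eq_one_or (Equiv.Perm.sign s) with h | h <;> rw [h]
  · simpa using h1
  · simpa using h1.neg

theorem isHomogeneous_resultant {τ R : Type*} [CommRing R] {P Q : Polynomial (MvPolynomial τ R)}
    (hP : ∀ l, (P.coeff l).IsHomogeneous 1) (hQ : ∀ l, (Q.coeff l).IsHomogeneous 1) (a b : ℕ) :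
    (Polynomial.resultant P Q a b).IsHomogeneous (a + b) := by
  have := isHomogeneous_det (N := Polynomial.sylvester P Q a b) fun i j => by
    induction j using Fin.addCases <;> simp only [Polynomial.sylvester, Matrix.of_apply,
      Fin.addCases_left, Fin.addCases_right]
    all_goals split_ifs
    any_goals exact MvPolynomial.isHomogeneous_zero _ _ _
    · exact hQ _
    · exact hP _
  rwa [Fintype.card_fin] at this

variable {L : Type*} [Field L] [IsAlgClosed L]

/-- Having no common zero on the projective line is an open condition on tuples of binary forms. -/
theorem exists_form_of_formTuple_ne_zero {v : Fin n × Fin (e + 1) → L} (hv : v ≠ 0)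
    (h : ∀ p : Fin 2 → L, p ≠ 0 → formTuple v p ≠ 0) :
    ∃ (b : ℕ) (H : MvPolynomial (Fin n × Fin (e + 1)) L), H.IsHomogeneous b ∧
      MvPolynomial.eval v H ≠ 0 ∧ ∀ w : Fin n × Fin (e + 1) → L, w ≠ 0 →
        MvPolynomial.eval w H ≠ 0 → ∀ p : Fin 2 → L, p ≠ 0 → formTuple w p ≠ 0 := by
  classical
  by_cases he : e = 0
  · subst he
    refine ⟨0, 1, MvPolynomial.isHomogeneous_one _ _, by simp, fun w hw _ p _ hp => hw ?_⟩
    funext ⟨j, l, hl⟩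
    obtain rfl : l = 0 := by omega
    simpa [formTuple] using congrFun hp j
  have hlast : ∃ j, v (j, Fin.last e) ≠ 0 := by
    by_contra! hall
    refine h ![1, 0] (fun h0 => by simpa using congrFun h0 0) ?_
    funext j
    rw [formTuple_of_eq_zero v (by simp), hall j, zero_mul]; rfl
  obtain ⟨j₀, hj₀⟩ := hlast
  set a := polyTuple v j₀ with ha
  have hae : a.coeff e ≠ 0 := by
    rw [ha, polyTuple_coeff, dif_pos (Nat.lt_succ_self e)]; exact hj₀
  have hadeg : a.natDegree = e :=
    le_antisymm (polyTuple_natDegree_le v j₀) (Polynomial.le_natDegree_of_ne_zero hae)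
  have ha0 : a ≠ 0 := by rintro h0; rw [h0] at hae; simp at hae
  have hcomb : ∀ (β : Fin n → L) (w : Fin n × Fin (e + 1) → L),
      (∑ j, Polynomial.C (β j) * polyTuple w j).natDegree ≤ e := fun β w =>
    Polynomial.natDegree_sum_le_of_forall_le _ _ fun j _ =>
      (Polynomial.natDegree_C_mul_le _ _).trans (polyTuple_natDegree_le w j)
  -- At each root of `a` some coordinate is nonzero, so a general combination of the coordinates
  -- vanishes at none of the roots. The required form is the resultant of `a` and this combination,
  -- with generic coefficients.
  obtain ⟨β, hβ⟩ := Module.Dual.exists_forall_ne_zero_of_forall_exists (K := L)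
    (ι := {s // s ∈ a.roots.toFinset})
    (fun s => Fintype.linearCombination L fun j => (polyTuple v j).eval s.1) (by
      intro s
      by_contra! hall
      refine h ![s.1, 1] (fun h0 => by simpa using congrFun h0 1) ?_
      funext j
      have := hall (Pi.single j 1)
      rw [Fintype.linearCombination_apply_single] at this
      rw [formTuple_affine]
      simpa using this)
  set b := ∑ j, Polynomial.C (β j) * polyTuple v j with hb
  have hcop : IsCoprime a b := by
    rw [Polynomial.isCoprime_iff_aeval_ne_zero_of_isAlgClosed L L]
    intro s
    by_cases hs : Polynomial.aeval s a = 0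
    · right
      have := hβ ⟨s, by simpa [ha0] using hs⟩
      rw [Fintype.linearCombination_apply] at this
      simpa [hb, Polynomial.eval_finsetSum] using this
    · exact Or.inl hs
  let gen := polyTuple (n := n) (e := e) (A := MvPolynomial (Fin n × Fin (e + 1)) L) MvPolynomial.X
  let ρ := Polynomial.resultant (gen j₀)
    (∑ j, Polynomial.C (MvPolynomial.C (β j)) * gen j) e e
  have hρ : ∀ w, MvPolynomial.eval w ρ = Polynomial.resultant (polyTuple w j₀)
      (∑ j, Polynomial.C (β j) * polyTuple w j) e e := fun w => by
    have hgw : ∀ j, (gen j).map (MvPolynomial.eval w) = polyTuple w j := fun j => by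
      simp [gen, polyTuple_map]
    rw [← Polynomial.resultant_map_map, Polynomial.map_sum, hgw]
    congr 1
    exact Finset.sum_congr rfl fun j _ => by
      rw [Polynomial.map_mul, Polynomial.map_C, MvPolynomial.eval_C, hgw]
  have hgen : ∀ j l, ((gen j).coeff l).IsHomogeneous 1 := fun j l => by
    simp only [gen]
    rw [polyTuple_coeff]
    split_ifs
    · exact MvPolynomial.isHomogeneous_X _ _
    · exact MvPolynomial.isHomogeneous_zero _ _ _
  refine ⟨e + e, ρ, isHomogeneous_resultant (hgen j₀) (fun l => ?_) e e, ?_, ?_⟩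
  · rw [Polynomial.finsetSum_coeff]
    refine MvPolynomial.IsHomogeneous.sum _ _ _ fun j _ => ?_
    rw [Polynomial.coeff_C_mul]
    exact (hgen j l).C_mul _
  · rw [hρ, ← ha, ← hb]
    -- The degree of `b` may be below `e`; taking formal degree `e` only multiplies the resultant by
    -- a unit, as `a` has degree exactly `e`.
    obtain ⟨m, hm⟩ := Nat.exists_eq_add_of_le (hcomb β v)
    rw [← hb] at hm
    have h1 := Polynomial.resultant_add_right_deg a b e b.natDegree m le_rfl
    rw [← hm] at h1
    rw [h1]
    refine mul_ne_zero (pow_ne_zero _ hae) ?_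
    have h2 := Polynomial.resultant_ne_zero a b hcop
    rwa [hadeg] at h2
  · intro w _ hw p hp hzero
    rw [hρ] at hw
    have hj : ∀ j, formTuple w p j = 0 := fun j => congrFun hzero j
    -- At a common zero at infinity both degrees drop below `e`; at a finite one, the resultant is a
    -- combination of two polynomials with a common root.
    by_cases hp1 : p 1 = 0
    · have hp0 : p 0 ≠ 0 := fun h0 => hp (by funext i; fin_cases i; exacts [h0, hp1])
      have hw0 : ∀ j, (polyTuple w j).coeff e = 0 := fun j => by
        rw [polyTuple_coeff, dif_pos (Nat.lt_succ_self e)]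
        have := hj j
        rw [formTuple_of_eq_zero w hp1] at this
        exact (mul_eq_zero.mp this).resolve_right (pow_ne_zero _ hp0)
      have hlt : ∀ q : Polynomial L, q.natDegree ≤ e → q.coeff e = 0 → q.natDegree < e := by
        intro q hq hqe
        refine lt_of_le_of_ne hq fun heq => ?_
        rw [← heq, Polynomial.coeff_natDegree, Polynomial.leadingCoeff_eq_zero] at hqe
        rw [hqe, Polynomial.natDegree_zero] at heq
        exact he heq.symm
      refine hw (Polynomial.resultant_eq_zero_of_lt_lt _ _ _ _
        (hlt _ (polyTuple_natDegree_le w j₀) (hw0 j₀)) (hlt _ (hcomb β w) ?_))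
      simp [Polynomial.finsetSum_coeff, hw0]
    · have hroot : ∀ j, (polyTuple w j).eval (p 0 / p 1) = 0 := fun j => by
        have := hj j
        rw [formTuple_of_ne_zero w hp1] at this
        exact (mul_eq_zero.mp this).resolve_left (pow_ne_zero _ hp1)
      obtain ⟨x, y, -, -, hxy⟩ := Polynomial.exists_mul_add_mul_eq_C_resultant (polyTuple w j₀)
        (∑ j, Polynomial.C (β j) * polyTuple w j) (polyTuple_natDegree_le w j₀) (hcomb β w)
        (Or.inl he)
      have := congrArg (Polynomial.eval (p 0 / p 1)) hxy
      simp only [Polynomial.eval_add, Polynomial.eval_mul, Polynomial.eval_finsetSum,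
        Polynomial.eval_C, hroot, mul_zero, zero_mul, Finset.sum_const_zero, add_zero] at this
      exact hw this.symm

end Resultant

end Coefficients

/-! ### The space of morphisms as a locally closed set -/

section MorSpace

variable {n e : ℕ} {k : Type*} [Field k] {ι : Type*}

theorem aeval_rep_mk_eq_zero_iff {L : Type*} [Field L] [Algebra k L] {F : MvPolynomial (Fin n) k}
    {d : ℕ} (hF : F.IsHomogeneous d) {w : Fin n → L} (hw : w ≠ 0) :
    MvPolynomial.aeval (Projectivization.mk L w hw).rep F = 0 ↔ MvPolynomial.aeval w F = 0 := by
  rw [aeval_eq_eval_map, aeval_eq_eval_map]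
  exact not_iff_not.mp (eval_rep_mk_ne_zero_iff (hF.map _) hw)

/-- The conditions on a coefficient vector defining `morSpace`. -/
def IsMorVector {L : Type*} [Field L] [Algebra k L] (F : ι → MvPolynomial (Fin n) k)
    (G : Set (MvPolynomial (Fin n) k)) (v : Fin n × Fin (e + 1) → L) : Prop :=
  (∀ p : Fin 2 → L, p ≠ 0 → formTuple v p ≠ 0) ∧
    (∀ i, MvPolynomial.aeval (polyTuple v) (F i) = 0) ∧
      ∃ p : Fin 2 → L, p ≠ 0 ∧ ∃ g ∈ G, MvPolynomial.aeval (formTuple v p) g ≠ 0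

variable {F : ι → MvPolynomial (Fin n) k} {G : Set (MvPolynomial (Fin n) k)} {d : ι → ℕ}

theorem mem_morSpace_iff (hF : ∀ i, (F i).IsHomogeneous (d i))
    (hG : ∀ g ∈ G, ∃ m : ℕ, g.IsHomogeneous m)
    {f : ℙ (AlgebraicClosure k) (Fin n × Fin (e + 1) → AlgebraicClosure k)} :
    f ∈ morSpace F G e ↔ IsMorVector F G f.rep := by
  have hzero : ∀ w (hw : w ≠ 0), Projectivization.mk (AlgebraicClosure k) w hw ∈
      zeroLocus F (AlgebraicClosure k) ↔ ∀ i, MvPolynomial.aeval w (F i) = 0 := fun w hw =>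
    forall_congr' fun i => aeval_rep_mk_eq_zero_iff (hF i) hw
  constructor
  · rintro ⟨h1, p, hp, hp0, -, g, hg, hgp⟩
    refine ⟨fun p hp => (h1 p hp).1, fun i => ?_, p, hp, g, hg, ?_⟩
    · rw [aeval_polyTuple_eq_zero_iff (hF i)]
      exact fun p hp => (hzero _ (h1 p hp).1).mp (h1 p hp).2 i
    · obtain ⟨m, hm⟩ := hG g hg
      exact (not_congr (aeval_rep_mk_eq_zero_iff hm hp0)).mp hgp
  · rintro ⟨h1, h2, p, hp, g, hg, hgp⟩
    have hmem : ∀ p (hp : p ≠ 0), Projectivization.mk _ (formTuple f.rep p) (h1 p hp) ∈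
        zeroLocus F (AlgebraicClosure k) := fun p hp =>
      (hzero _ _).mpr fun i => (aeval_polyTuple_eq_zero_iff (hF i) _).mp (h2 i) p hp
    obtain ⟨m, hm⟩ := hG g hg
    exact ⟨fun p hp => ⟨h1 p hp, hmem p hp⟩, p, hp, h1 p hp, hmem p hp, g, hg,
      (not_congr (aeval_rep_mk_eq_zero_iff hm (h1 p hp))).mpr hgp⟩

theorem IsMorVector.smul {L : Type*} [Field L] [Infinite L] [Algebra k L]
    (hF : ∀ i, (F i).IsHomogeneous (d i)) (hG : ∀ g ∈ G, ∃ m : ℕ, g.IsHomogeneous m)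
    {v : Fin n × Fin (e + 1) → L} (hv : IsMorVector F G v) {c : L} (hc : c ≠ 0) :
    IsMorVector F G (c • v) := by
  obtain ⟨h1, h2, p, hp, g, hg, hgp⟩ := hv
  refine ⟨fun p hp => ?_, fun i => ?_, p, hp, g, hg, ?_⟩
  · rw [formTuple_smul]
    exact smul_ne_zero hc (h1 p hp)
  · rw [aeval_polyTuple_eq_zero_iff (hF i)]
    intro p hp
    rw [formTuple_smul, aeval_smul_of_isHomogeneous (hF i),
      (aeval_polyTuple_eq_zero_iff (hF i) v).mp (h2 i) p hp, mul_zero]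
  · obtain ⟨m, hm⟩ := hG g hg
    rw [formTuple_smul, aeval_smul_of_isHomogeneous hm]
    exact mul_ne_zero (pow_ne_zero _ hc) hgp

theorem mk_mem_morSpace (hF : ∀ i, (F i).IsHomogeneous (d i))
    (hG : ∀ g ∈ G, ∃ m : ℕ, g.IsHomogeneous m) {v : Fin n × Fin (e + 1) → AlgebraicClosure k}
    (hv0 : v ≠ 0) (hv : IsMorVector F G v) :
    Projectivization.mk (AlgebraicClosure k) v hv0 ∈ morSpace F G e := by
  rw [mem_morSpace_iff hF hG]
  obtain ⟨c, hc⟩ := Projectivization.exists_smul_eq_mk_rep (AlgebraicClosure k) v hv0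
  rw [← hc]
  exact hv.smul hF hG c.ne_zero

/-- `morSpace` is locally closed. -/
theorem exists_form_of_mem_morSpace (hF : ∀ i, (F i).IsHomogeneous (d i))
    (hG : ∀ g ∈ G, ∃ m : ℕ, g.IsHomogeneous m)
    {f : ℙ (AlgebraicClosure k) (Fin n × Fin (e + 1) → AlgebraicClosure k)}
    (hf : f ∈ morSpace F G e) :
    ∃ (b : ℕ) (H : MvPolynomial (Fin n × Fin (e + 1)) (AlgebraicClosure k)), H.IsHomogeneous b ∧
      MvPolynomial.eval f.rep H ≠ 0 ∧
      ∀ Q : ℙ (AlgebraicClosure k) (Fin n × Fin (e + 1) → AlgebraicClosure k),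
        MvPolynomial.eval Q.rep H ≠ 0 →
        (∀ i, MvPolynomial.aeval (polyTuple Q.rep) (F i) = 0) → Q ∈ morSpace F G e := by
  obtain ⟨h1, -, p, hp, g, hg, hgp⟩ := (mem_morSpace_iff hF hG).mp hf
  obtain ⟨b, H, hH, hfH, hcop⟩ := exists_form_of_formTuple_ne_zero f.rep_nonzero h1
  obtain ⟨m, hm⟩ := hG g hg
  -- The value at the fixed point `p` is linear in the coefficients, so "`g` is nonzero at the image
  -- of `p`" is an open condition; it is multiplied with the resultant form.
  let y : Fin n → MvPolynomial (Fin n × Fin (e + 1)) (AlgebraicClosure k) := fun j =>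
    ∑ l : Fin (e + 1), MvPolynomial.C (p 0 ^ (l : ℕ) * p 1 ^ (e - (l : ℕ))) * MvPolynomial.X (j, l)
  have hy : ∀ j, (y j).IsHomogeneous 1 := fun j =>
    MvPolynomial.IsHomogeneous.sum _ _ _ fun l _ => MvPolynomial.isHomogeneous_C_mul_X _ _
  have hyv : ∀ v, MvPolynomial.eval v (MvPolynomial.aeval y g) =
      MvPolynomial.aeval (formTuple v p) g := fun v => by
    have : (MvPolynomial.eval v).comp (MvPolynomial.aeval y :
          MvPolynomial (Fin n) k →ₐ[k] _).toRingHom =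
        (MvPolynomial.aeval (formTuple v p) : MvPolynomial (Fin n) k →ₐ[k] _).toRingHom := by
      ext j
      · simp [MvPolynomial.algebraMap_apply]
      · simp only [RingHom.comp_apply, AlgHom.toRingHom_eq_coe, RingHom.coe_coe,
          MvPolynomial.aeval_X, y, map_sum, map_mul, MvPolynomial.eval_C, MvPolynomial.eval_X,
          formTuple]
        exact Finset.sum_congr rfl fun l _ => by ring
    exact congrArg (fun f => f g) this
  refine ⟨b + 1 * m, H * MvPolynomial.aeval y g, hH.mul (hm.aeval y hy), ?_, fun Q hQ hQF => ?_⟩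
  · rw [map_mul, hyv]
    exact mul_ne_zero hfH hgp
  · rw [map_mul, hyv] at hQ
    exact (mem_morSpace_iff hF hG).mpr ⟨hcop Q.rep Q.rep_nonzero (left_ne_zero_of_mul hQ), hQF,
      p, hp, g, hg, right_ne_zero_of_mul hQ⟩

end MorSpace

/-! ### From rational points to coefficient vectors -/

section RatPoints

open Polynomial

variable {n e : ℕ} {k : Type*} [Field k] {ι : Type*}
  {F : ι → MvPolynomial (Fin n) k} {G : Set (MvPolynomial (Fin n) k)} {d : ι → ℕ}

theorem algebraMap_aeval {A B : Type*} [CommRing A] [CommRing B] [Algebra k A] [Algebra k B]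
    (φ : A →ₐ[k] B) (y : Fin n → A) (f : MvPolynomial (Fin n) k) :
    φ (MvPolynomial.aeval y f) = MvPolynomial.aeval (fun j => φ (y j)) f :=
  (MvPolynomial.comp_aeval_apply y φ f).symm ▸ rfl

/-- A rational point of height `q ^ e` has primitive coordinates whose coefficient vector lies on
the affine cone over `morSpace`. -/
theorem exists_coeffVector [Finite k] (hF : ∀ i, (F i).IsHomogeneous (d i))
    (hG : ∀ g ∈ G, ∃ m : ℕ, g.IsHomogeneous m) {P : ℙ (RatFunc k) (Fin n → RatFunc k)}
    (hP : P ∈ ratPoints F G e) :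
    ∃ y : Fin n → k[X], IsPrimitiveRep P y ∧ (∀ j, (y j).natDegree ≤ e) ∧
      ∃ h : (fun x : Fin n × Fin (e + 1) =>
          algebraMap k (AlgebraicClosure k) ((y x.1).coeff x.2)) ≠ 0,
        Projectivization.mk (AlgebraicClosure k) _ h ∈ morSpace F G e := by
  obtain ⟨y, hy⟩ := exists_isPrimitiveRep P
  obtain ⟨⟨hPF, g, hg, hgP⟩, hheight⟩ := hP
  have hsup : Finset.univ.sup (fun j => (y j).natDegree) = e := by
    rw [← hy.logHeight_eq]
    exact Nat.pow_right_injective (Finite.one_lt_card (α := k)) hheight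
  have hdeg : ∀ j, (y j).natDegree ≤ e := fun j =>
    hsup ▸ Finset.le_sup (f := fun j => (y j).natDegree) (Finset.mem_univ j)
  obtain ⟨hspan, hy0, hPy⟩ := hy
  set v : Fin n × Fin (e + 1) → AlgebraicClosure k := fun x =>
    algebraMap k (AlgebraicClosure k) ((y x.1).coeff x.2) with hv
  set Y : Fin n → (AlgebraicClosure k)[X] := fun j =>
    (y j).map (algebraMap k (AlgebraicClosure k)) with hY
  have hvY : polyTuple v = Y := by
    funext j
    ext l
    rw [polyTuple_coeff, hY, coeff_map]
    split_ifs with hl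
    · rfl
    · rw [coeff_eq_zero_of_natDegree_lt (lt_of_le_of_lt (hdeg j) (by omega)), map_zero]
  -- This excludes a common zero at infinity; finite ones are excluded by coprimality. The case `e =
  -- 0` is separate because the zero polynomial also has `natDegree` 0.
  have htop : ∃ j, (y j).coeff e ≠ 0 := by
    have hyne : ∃ j, y j ≠ 0 := by
      by_contra! hall
      exact hy0 (funext fun j => by simp [hall j])
    obtain ⟨j, hj, hje⟩ : ∃ j, y j ≠ 0 ∧ (y j).natDegree = e := by
      obtain ⟨j₀, hj₀⟩ := hyne
      obtain ⟨j, -, hj⟩ := Finset.exists_mem_eq_sup Finset.univ ⟨j₀, Finset.mem_univ j₀⟩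
        fun j => (y j).natDegree
      rw [hsup] at hj
      by_cases he : e = 0
      · exact ⟨j₀, hj₀, by have := hdeg j₀; omega⟩
      · refine ⟨j, fun h0 => he ?_, hj.symm⟩
        rw [hj, h0, natDegree_zero]
    exact ⟨j, by rw [← hje, coeff_natDegree]; exact leadingCoeff_ne_zero.mpr hj⟩
  have hinj := (algebraMap k (AlgebraicClosure k)).injective
  have hv0 : v ≠ 0 := fun h0 => by
    obtain ⟨j, hj⟩ := htop
    apply hj
    apply hinj
    rw [map_zero]
    exact congrFun h0 (j, Fin.last e)
  let φ : k[X] →ₐ[k] (AlgebraicClosure k)[X] := mapAlgHom (Algebra.ofId k (AlgebraicClosure k))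
  have hφ : Function.Injective φ := Polynomial.map_injective _ hinj
  have hYφ : ∀ f : MvPolynomial (Fin n) k, MvPolynomial.aeval Y f =
      φ (MvPolynomial.aeval y f) := fun f => (algebraMap_aeval φ y f).symm
  let ψ : k[X] →ₐ[k] RatFunc k := IsScalarTower.toAlgHom k k[X] (RatFunc k)
  have hψ : Function.Injective ψ := IsFractionRing.injective k[X] (RatFunc k)
  have hPψ : ∀ f : MvPolynomial (Fin n) k, ∀ m, f.IsHomogeneous m →
      (MvPolynomial.aeval P.rep f = 0 ↔ MvPolynomial.aeval Y f = 0) := fun f m hf => by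
    rw [hPy, aeval_rep_mk_eq_zero_iff hf, hYφ, map_eq_zero_iff φ hφ, ← map_eq_zero_iff ψ hψ,
      algebraMap_aeval]
    rfl
  refine ⟨y, ⟨hspan, hy0, hPy⟩, hdeg, hv0, mk_mem_morSpace hF hG hv0 ⟨?_, fun i => ?_, ?_⟩⟩
  · intro p hp hzero
    by_cases hp1 : p 1 = 0
    · have hp0 : p 0 ≠ 0 := fun h0 => hp (by funext i; fin_cases i; exacts [h0, hp1])
      obtain ⟨j, hj⟩ := htop
      have := congrFun hzero j
      rw [formTuple_of_eq_zero v hp1] at this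
      have h2 : v (j, Fin.last e) = 0 := (mul_eq_zero.mp this).resolve_right (pow_ne_zero _ hp0)
      exact hj (hinj (by rw [map_zero]; exact h2))
    · obtain ⟨r, hr⟩ := Ideal.mem_span_range_iff_exists_fun.mp ((Ideal.eq_top_iff_one _).mp hspan)
      have hr' := congrArg (fun q => (q.map (algebraMap k (AlgebraicClosure k))).eval (p 0 / p 1)) hr
      have hroot : ∀ j, (Y j).eval (p 0 / p 1) = 0 := fun j => by
        have := congrFun hzero j
        rw [formTuple_of_ne_zero v hp1, hvY] at this
        exact (mul_eq_zero.mp this).resolve_left (pow_ne_zero _ hp1)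
      simp only [Polynomial.map_sum, Polynomial.map_mul, eval_finsetSum, eval_mul,
        Polynomial.map_one, eval_one] at hr'
      rw [Finset.sum_eq_zero fun j _ => by rw [hroot j, mul_zero]] at hr'
      exact zero_ne_one hr'
  · rw [hvY]
    exact (hPψ (F i) (d i) (hF i)).mp (hPF i)
  · obtain ⟨m, hm⟩ := hG g hg
    have hgY : MvPolynomial.aeval Y g ≠ 0 := (not_congr (hPψ g m hm)).mp hgP
    obtain ⟨s, hs⟩ : ∃ s, (MvPolynomial.aeval Y g).eval s ≠ 0 := by
      by_contra! hall
      exact hgY (Polynomial.funext fun s => by rw [hall s, eval_zero])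
    refine ⟨![s, 1], fun h0 => by simpa using congrFun h0 1, g, hg, ?_⟩
    have : formTuple v ![s, 1] = fun j => (Y j).eval s := by
      funext j; rw [formTuple_affine, hvY]
    rwa [this, ← eval_aeval]

end RatPoints

/-! ### The final bound -/

section Main

open Polynomial

/-- Each positive `d i` contributes d_i^(d_i e + 1) = d_i (d_i^{d_i})^e. The maximum with 1 serves
degree 0, where 0^0 = 1. -/
theorem prod_max_one_eq {R : ℕ} (d : Fin R → ℕ) (e : ℕ) :
    ∏ x : (i : Fin R) × Fin (d i * e + 1), max (d x.1) 1 =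
      (∏ i, max (d i) 1) * (∏ i, d i ^ d i) ^ e := by
  rw [Fintype.prod_sigma, ← Finset.prod_pow, ← Finset.prod_mul_distrib]
  refine Finset.prod_congr rfl fun i _ => ?_
  change ∏ _y : Fin (d i * e + 1), max (d i) 1 = _
  rw [Finset.prod_const, Finset.card_univ, Fintype.card_fin, pow_succ, mul_comm, pow_mul]
  rcases Nat.eq_zero_or_pos (d i) with h | h
  · simp [h]
  · rw [max_eq_left h]

theorem ratPoints_bound {k : Type*} [Field k] [Finite k] {R n e : ℕ} {d : Fin R → ℕ}
    {F : Fin R → MvPolynomial (Fin n) k} (hF : ∀ i, (F i).IsHomogeneous (d i))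
    {G : Set (MvPolynomial (Fin n) k)} (hG : ∀ g ∈ G, ∃ m : ℕ, g.IsHomogeneous m) :
    (ratPoints F G e).Finite ∧
      ((morSpace F G e = ∅ ∧ ratPoints F G e = ∅) ∨
        ∃ D : ℕ, zariskiDim (morSpace F G e) = (D : WithBot ℕ∞) ∧
          (ratPoints F G e).ncard ≤
            (∏ i, max (d i) 1) * (∏ i, d i ^ d i) ^ e * Nat.card k ^ (D + 1)) := by
  classical
  have := Fintype.ofFinite k
  choose y hyP hydeg hyM using fun P : ratPoints F G e => exists_coeffVector hF hG P.2
  let T : Finset (AlgebraicClosure k) :=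
    Finset.univ.map ⟨algebraMap k (AlgebraicClosure k), (algebraMap k _).injective⟩
  have hTcard : T.card = Nat.card k := by simp [T]
  let v : ratPoints F G e → Fin n × Fin (e + 1) → AlgebraicClosure k := fun P x =>
    algebraMap k (AlgebraicClosure k) ((y P x.1).coeff x.2)
  have hvT : ∀ P x, v P x ∈ T := fun P x => by simp [T, v]
  have hinj : Function.Injective v := fun P Q hPQ => by
    have hy : y P = y Q := by
      funext j
      ext l
      by_cases hl : l < e + 1
      · exact (algebraMap k (AlgebraicClosure k)).injective (congrFun hPQ (j, ⟨l, hl⟩))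
      · rw [coeff_eq_zero_of_natDegree_lt ((hydeg P j).trans_lt (by omega)),
          coeff_eq_zero_of_natDegree_lt ((hydeg Q j).trans_lt (by omega))]
    obtain ⟨-, h1, hP⟩ := hyP P
    obtain ⟨-, h2, hQ⟩ := hyP Q
    apply Subtype.ext
    rw [hP, hQ]
    simp only [hy]
  have hfin : Finite (ratPoints F G e) :=
    Finite.of_injective (fun P x => (⟨v P x, hvT P x⟩ : T)) fun P Q h =>
      hinj (funext fun x => congrArg Subtype.val (congrFun h x))
  refine ⟨hfin, ?_⟩
  rcases (morSpace F G e).eq_empty_or_nonempty with hM | hM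
  · refine Or.inl ⟨hM, Set.eq_empty_of_forall_notMem fun P hP => ?_⟩
    obtain ⟨_, hmem⟩ := hyM ⟨P, hP⟩
    rw [hM] at hmem
    exact hmem
  right
  obtain ⟨D, hD, hcard⟩ := exists_zariskiDim_eq_and_card_le
    (f := fun x : (i : Fin R) × Fin (d i * e + 1) =>
      coeffEquation (AlgebraicClosure k) e (F x.1) x.2)
    (d := fun x => d x.1) (δ := fun x => max (d x.1) 1)
    (fun x => isHomogeneous_coeffEquation (hF x.1) x.2) (fun x => le_max_right _ _)
    (fun x => le_max_left _ _) hM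
    (fun Q hQ x => (forall_coeffEquation_iff (hF x.1) Q.rep).mpr
      (((mem_morSpace_iff hF hG).mp hQ).2.1 x.1) x.2)
    (fun P hP => by
      obtain ⟨b, H, hH, hPH, hQ⟩ := exists_form_of_mem_morSpace hF hG hP
      exact ⟨b, H, hH, hPH, fun Q hQH hQf => hQ Q hQH fun i =>
        (forall_coeffEquation_iff (hF i) Q.rep).mp fun l => hQf ⟨i, l⟩⟩)
  refine ⟨D, hD, ?_⟩
  have := Fintype.ofFinite (ratPoints F G e)
  have h := hcard T ⟨_, Finset.mem_map_of_mem _ (Finset.mem_univ (0 : k))⟩ v hinj hvT hyM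
  rwa [hTcard, prod_max_one_eq, ← Nat.card_eq_fintype_card, Nat.card_coe_set_eq] at h

end Main

end RatCurves

/-- The constant `K` depends only on `q` and on `d_1, …, d_R`. Neither smoothness nor the Fano
property of `X = V(F_1, …, F_R)` is assumed, so the statement covers in particular every smooth
Fano variety. The first alternative is the case `dim = -∞`. -/
theorem theorem1p2 (Fq : Type*) [Field Fq] [Finite Fq] (R : ℕ) (d : Fin R → ℕ) :
    ∃ K : ℝ, 0 < K ∧
      ∀ (n : ℕ) (F : Fin R → MvPolynomial (Fin n) Fq), (∀ i, (F i).IsHomogeneous (d i)) →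
      ∀ G : Set (MvPolynomial (Fin n) Fq), (∀ g ∈ G, ∃ m : ℕ, g.IsHomogeneous m) →
      ∀ e : ℕ,
        (RatCurves.ratPoints F G e).Finite ∧
        ((RatCurves.morSpace F G e = ∅ ∧ RatCurves.ratPoints F G e = ∅) ∨
          ∃ D : ℕ, RatCurves.zariskiDim (RatCurves.morSpace F G e) = (D : WithBot ℕ∞) ∧
            ((RatCurves.ratPoints F G e).ncard : ℝ) ≤
              K * ((∏ i, d i ^ d i : ℕ) : ℝ) ^ e * (Nat.card Fq : ℝ) ^ D) := by
  have hprod : 0 < ∏ i, max (d i) 1 := Finset.prod_pos fun i _ => lt_max_of_lt_right one_pos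
  -- The factor q absorbs the exponent D + 1 of the affine cone.
  refine ⟨((∏ i, max (d i) 1) * Nat.card Fq : ℕ), by
    exact_mod_cast Nat.mul_pos hprod Nat.card_pos, fun n F hF G hG e => ?_⟩
  obtain ⟨hfin, h⟩ := RatCurves.ratPoints_bound (e := e) hF hG
  refine ⟨hfin, h.imp_right ?_⟩
  rintro ⟨D, hD, hle⟩
  refine ⟨D, hD, ?_⟩
  have : (RatCurves.ratPoints F G e).ncard ≤
      (∏ i, max (d i) 1) * Nat.card Fq * (∏ i, d i ^ d i) ^ e * Nat.card Fq ^ D :=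
    hle.trans (le_of_eq (by ring))
  exact_mod_cast this
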